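/- **Setting.** Fix integers $K\ge 1$ and $1\le r<s$, quantile levels $0<\tau_1<\dots<\tau_K<1$, weights $w_1,\dots,w_K>0$ and an index $k^*\in\{1,\dots,K\}$. For each sample size $(N,T)$ one observes real random variables $X_{it}$ ($1\le i\le N$, $1\le t\le T$; the array may depend on $(N,T)$) and there are non-random true loadings $\lambda^0_{k,i}\in\mathbb R^r$ and factors $f^0_t\in\mathbb R^r$ (also allowed to depend on $(N,T)$) such that the $\tau_k$-quantile of $X_{it}$ is $\lambda_{k,i}^{0\prime}f^0_t$ for all $k,i,t$. Let $X_{it}$ have the probability density $h_{it}$. Write $\Lambda_k^0$ and $F^0$ for the matrices with rows $\lambda_{k,i}^{0\prime}$ and $f_t^{0\prime}$, let $L_{NT}=\min\{\sqrt N,\sqrt T\}$ and $\rho_\tau(\epsilon)=(\tau-\mathbf 1\{\epsilon\le 0\})\epsilon$. For each $\ell\in\{1,\dots,s\}$ let $\mathcal A^\ell,\mathcal F^\ell\subset\mathbb R^\ell$ be compact sets, not depending on $(N,T)$, and let $\Theta^\ell=\Theta^\ell_{NT}$ be the set of $\theta=(\lambda_{k,i},f_t)_{k,i,t}$ with $\lambda_{k,i}\in\mathcal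 A^\ell$, $f_t\in\mathcal F^\ell$, $F'F/T=I_\ell$ and $\Lambda_{k^*}'\Lambda_{k^*}/N$ diagonal with non-increasing diagonal entries, where $\Lambda_k$ and $F$ are the matrices with rows $\lambda_{k,i}'$ and $f_t'$. For $\theta\in\Theta^\ell$ put $$M_{NT}(\theta)=\frac1{NT}\sum_{k=1}^K\sum_{i=1}^N\sum_{t=1}^T w_k\,\rho_{\tau_k}(X_{it}-\lambda_{k,i}'f_t),\qquad \hat\theta^\ell\in\operatorname*{argmin}_{\theta\in\Theta^\ell}M_{NT}(\theta);$$ it is presupposed that $\Theta^\ell\neq\emptyset$ for all large $N,T$, so that minimizers exist. All conditions below on the sample of size $(N,T)$ are required for all sufficiently large $N$ and $T$. **Assumptions.** 1. (a) $\mathcal A^\ell$ and $\mathcal F^\ell$ are compact. (b) The true parameter $\theta^0$ belongs to $\Theta^r$, and $\Lambda_{k^*}^{0\prime}\Lambda^0_{k^*}/N=\operatorname{diag}(\nu_1^{(N,T)},\dots,\nu_r^{(N,T)})$ with $\nu_j^{(N,T)}\to\nu_j$ as $N,T\to\infty$, where $\nu_1>\dots>\nu_r>0$. (c) For every compact $C\subset\mathbb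 R$ there is $c>0$ such that $h_{it}(x)\ge c$ for all $x\in C$ and all $i,t$ (uniformly in large $N,T$). (d) For every $k$, the errors $\epsilon_{k,it}=X_{it}-\lambda^{0\prime}_{k,i}f^0_t$ are independent across $(i,t)$. 2. (a) For every compact $C\subset\mathbb R$ there is $c>0$ such that $h_{it}(x)\le c$ for all $x\in C$ and all $i,t$ (uniformly in large $N,T$). (b) For every $\ell$ with $r<\ell\le s$, the rows of $[\Lambda_k^0\ \ 0_{N\times(\ell-r)}]$ lie in $\mathcal A^\ell$ for all $k$, and there is $V\in\mathbb R^{T\times(\ell-r)}$ such that $F^*=[F^0\ \ V]$ satisfies $F^{*\prime}F^*/T=I_\ell$ and has all its rows in $\mathcal F^\ell$. **Theorem.** Let $(P_{NT})$ be real numbers with $P_{NT}\to0$ and $P_{NT}L_{NT}^2\to\infty$ as $N,T\to\infty$, and let $$\hat r\in\operatorname*{argmin}_{1\le\ell\le s}\big\{M_{NT}(\hat\theta^\ell)+\ell\,P_{NT}\big\}.$$ Then $P(\hat r=r)\to1$ as $N,T\to\infty$. (This holds for every choice of the minimizers; if $\hat r$ is not measurable, the outer probability of $\{\hat r\ne r\}$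 tends to $0$.) -/

import Mathlib

open Filter Topology MeasureTheory ProbabilityTheory
open scoped Matrix

/-- The check function `ρ_τ(ε) = (τ - 1{ε ≤ 0}) ε`. -/
noncomputable def checkLoss (τ ε : ℝ) : ℝ :=
  (τ - if ε ≤ 0 then 1 else 0) * ε

/-- A parameter `θ` with `ℓ` factors: the loading matrices `Λ_1, …, Λ_K` (of size `N × ℓ`, with
rows `λ_{k,i}`) and the factor matrix `F` (of size `T × ℓ`, with rows `f_t`). -/
structure FactorParam (K N T ℓ : ℕ) where
  loading : Fin K → Matrix (Fin N) (Fin ℓ) ℝ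
  factor : Matrix (Fin T) (Fin ℓ) ℝ

/-- The common component `λ_{k,i}' f_t`. -/
def FactorParam.common {K N T ℓ : ℕ} (θ : FactorParam K N T ℓ)
    (k : Fin K) (i : Fin N) (t : Fin T) : ℝ :=
  θ.loading k i ⬝ᵥ θ.factor t

/-- The matrix `Λ_k' Λ_k / N`. -/
noncomputable def FactorParam.loadingGram {K N T ℓ : ℕ} (θ : FactorParam K N T ℓ) (k : Fin K) :
    Matrix (Fin ℓ) (Fin ℓ) ℝ :=
  (N : ℝ)⁻¹ • ((θ.loading k)ᵀ * θ.loading k)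

/-- The normalization: `F' F / T` is the identity, and `Λ_{k*}' Λ_{k*} / N` is diagonal with
non-increasing diagonal entries. -/
def FactorParam.Normalized {K N T ℓ : ℕ} (kstar : Fin K) (θ : FactorParam K N T ℓ) : Prop :=
  (T : ℝ)⁻¹ • (θ.factorᵀ * θ.factor) = 1 ∧
  (θ.loadingGram kstar).IsDiag ∧ Antitone (θ.loadingGram kstar).diag

/-- The parameter space `Θ^ℓ`. -/
def paramSpace {K : ℕ} (kstar : Fin K) {ℓ : ℕ} (A F : Set (Fin ℓ → ℝ)) (N T : ℕ) :
    Set (FactorParam K N T ℓ) :=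
  {θ | (∀ k i, θ.loading k i ∈ A) ∧ (∀ t, θ.factor t ∈ F) ∧ θ.Normalized kstar}

/-- The objective function `M_{NT}(θ)` for the data `x`. -/
noncomputable def objective {K N T ℓ : ℕ} (τ w : Fin K → ℝ) (x : Fin N → Fin T → ℝ)
    (θ : FactorParam K N T ℓ) : ℝ :=
  ((N : ℝ) * T)⁻¹ * ∑ k, ∑ i, ∑ t, w k * checkLoss (τ k) (x i t - θ.common k i t)

/-- The quantile at level `p` of a probability measure on the line. -/
noncomputable def quantile (μ : Measure ℝ) (p : ℝ) : ℝ :=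
  sInf {x : ℝ | p ≤ cdf μ x}

/-- `h` is a probability density function of `μ`. -/
def IsDensityOf (h : ℝ → ℝ) (μ : Measure ℝ) : Prop :=
  Measurable h ∧ (∀ x, 0 ≤ h x) ∧ μ = volume.withDensity (fun x => ENNReal.ofReal (h x))

/-- `L_{NT} = min {√N, √T}`. -/
noncomputable def rateL (N T : ℕ) : ℝ := min (Real.sqrt N) (Real.sqrt T)

/-- The data-adaptive factor model with `r` factors, the true factors and loadings `θ₀` being
non-random and forming an array in `(N, T)`. The quantile of `X_{it}` at level `τ_k` is
`λ⁰_{k,i}' f⁰_t`, and `h_{it}` is the density of `X_{it}`. -/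
structure FactorModel {Ω : Type*} [MeasurableSpace Ω] (P : Measure Ω) {K r : ℕ} (τ : Fin K → ℝ)
    (X : (N T : ℕ) → Fin N → Fin T → Ω → ℝ)
    (h : (N T : ℕ) → Fin N → Fin T → ℝ → ℝ)
    (θ₀ : (N T : ℕ) → FactorParam K N T r) : Prop where
  measurable : ∀ N T i t, Measurable (X N T i t)
  quantile_eq : ∀ᶠ p : ℕ × ℕ in atTop, ∀ k i t,
    quantile (P.map (X p.1 p.2 i t)) (τ k) = (θ₀ p.1 p.2).common k i t
  density : ∀ᶠ p : ℕ × ℕ in atTop, ∀ i t,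
    IsDensityOf (h p.1 p.2 i t) (P.map (X p.1 p.2 i t))

/-- The assumptions under which the estimators are consistent. -/
structure ConsistencyAssumption {Ω : Type*} [MeasurableSpace Ω] (P : Measure Ω) {K r : ℕ}
    (kstar : Fin K) (A F : (ℓ : ℕ) → Set (Fin ℓ → ℝ))
    (X : (N T : ℕ) → Fin N → Fin T → Ω → ℝ)
    (h : (N T : ℕ) → Fin N → Fin T → ℝ → ℝ)
    (θ₀ : (N T : ℕ) → FactorParam K N T r) : Prop where
  /-- The sets of possible loadings and factors are compact. -/
  compact : ∀ ℓ, IsCompact (A ℓ) ∧ IsCompact (F ℓ)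
  /-- The true parameter lies in the parameter space. -/
  true_mem : ∀ᶠ p : ℕ × ℕ in atTop, θ₀ p.1 p.2 ∈ paramSpace kstar (A r) (F r) p.1 p.2
  /-- The diagonal entries of `Λ⁰_{k*}' Λ⁰_{k*} / N` have limits `ν_1 > ⋯ > ν_r > 0`. -/
  eigen_limit : ∃ ν : Fin r → ℝ, StrictAnti ν ∧ (∀ j, 0 < ν j) ∧
    ∀ j, Tendsto (fun p : ℕ × ℕ => (θ₀ p.1 p.2).loadingGram kstar j j) atTop (𝓝 (ν j))
  /-- The densities are bounded away from zero on compact sets, uniformly in `i` and `t`. -/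
  density_lower : ∀ C : Set ℝ, IsCompact C → ∃ c > 0, ∀ᶠ p : ℕ × ℕ in atTop,
    ∀ i t, ∀ x ∈ C, c ≤ h p.1 p.2 i t x
  /-- For each `k`, the idiosyncratic errors are independent across `i` and `t`. -/
  indep : ∀ᶠ p : ℕ × ℕ in atTop, ∀ k,
    iIndepFun (fun (q : Fin p.1 × Fin p.2) (ω : Ω) =>
      X p.1 p.2 q.1 q.2 ω - (θ₀ p.1 p.2).common k q.1 q.2) P

/-- The additional assumptions for the estimation of the number of factors, up to `s` factors. -/
structure FactorNumberAssumption {K r : ℕ} (s : ℕ) (A F : (ℓ : ℕ) → Set (Fin ℓ → ℝ))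
    (h : (N T : ℕ) → Fin N → Fin T → ℝ → ℝ)
    (θ₀ : (N T : ℕ) → FactorParam K N T r) : Prop where
  /-- The densities are bounded on compact sets, uniformly in `i` and `t`. -/
  density_upper : ∀ C : Set ℝ, IsCompact C → ∃ c > 0, ∀ᶠ p : ℕ × ℕ in atTop,
    ∀ i t, ∀ x ∈ C, h p.1 p.2 i t x ≤ c
  /-- For `ℓ = r + m > r`, the rows of `Λ*_k = [Λ⁰_k 0]` lie in `A^ℓ` and, for some `V` such that
  `F* = [F⁰ V]` satisfies `F*' F* / T = I`, the rows of `F*` lie in `F^ℓ`. -/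
  augment : ∀ m : ℕ, 0 < m → r + m ≤ s → ∀ᶠ p : ℕ × ℕ in atTop,
    (∀ k i, (Fin.append ((θ₀ p.1 p.2).loading k i) 0 : Fin (r + m) → ℝ) ∈ A (r + m)) ∧
    ∃ V : Matrix (Fin p.2) (Fin m) ℝ, ∃ Fstar : Matrix (Fin p.2) (Fin (r + m)) ℝ,
      (∀ t, Fstar t = Fin.append ((θ₀ p.1 p.2).factor t) (V t)) ∧
      (p.2 : ℝ)⁻¹ • (Fstarᵀ * Fstar) = 1 ∧
      ∀ t, Fstar t ∈ F (r + m)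

/-! It suffices to compare every `θ ∈ Θ^ℓ`, `ℓ ≠ r`, with the truth `θ₀`, because `θ₀ ∈ Θ^r` makes
the fitted loss at `r` at most `M(θ₀)`. What is needed is a lower bound for `M(θ) - M(θ₀)` uniform
over `Θ^ℓ`. Rates for the estimators are not needed.

For each quantile level the loss difference is a convex function of the shift `d` of the common
component, an array of rank at most `ℓ + r`. Its mean is at least a multiple of `‖d‖²`, by the lower
density bound. In a ball with `δ² ≥ C (N + T)`, the loss exceeds this mean bound minus `ε δ²`,
uniformly and with high probability (`exists_measureReal_excessLoss_lt_le`). Hoeffding's inequality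
gives this on a net of bounded factor pairs, of size exponential in `N + T`. The subgradient
inequality carries it off the net at a fixed mesh, since the gradient noise has operator norm of
order `δ` while a difference of low-rank arrays is a few rank-one terms. Convexity along rays then
handles shifts outside the ball (`excessLoss_lower_of_ball`).

With `δ² = a N T`, this is available at every scale `a` with `a L² → ∞`. For `ℓ > r`, take `a` equal
to the penalty: overfitting gains only a small fraction of it, less than the price of an extra
factor. For `ℓ < r`, take `a` constant: missing a factor forces `‖d‖²` to be of order `N T`
(`le_sum_sq_sub_of_lt`), so the loss rises by a constant while the penalty vanishes. -/

/-! ### Volumetric nets in finite-dimensional balls -/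

section Nets

open Module Metric in
/-- A separated subset of the unit ball of a finite-dimensional normed space has a number of
elements that is at most exponential in the dimension. -/
lemma card_le_of_separated_unitBall {E : Type*} [NormedAddCommGroup E] [NormedSpace ℝ E]
    [FiniteDimensional ℝ E] {η : ℝ} (hη : 0 < η) (s : Finset E) (hs : ∀ c ∈ s, ‖c‖ ≤ 1)
    (h : ∀ c ∈ s, ∀ d ∈ s, c ≠ d → η ≤ ‖c - d‖) :
    (s.card : ℝ) ≤ (1 + 2 / η) ^ finrank ℝ E := by
  borelize E
  let μ : Measure E := Measure.addHaar
  have hδ : 0 < η / 2 := by positivity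
  have hρ : 0 < 1 + η / 2 := by positivity
  have D : Set.Pairwise (s : Set E) (Function.onFun Disjoint fun c => ball (c : E) (η / 2)) := by
    rintro c hc d hd hcd
    apply ball_disjoint_ball
    rw [dist_eq_norm]
    have := h c hc d hd hcd
    linarith
  have hsub : (⋃ c ∈ s, ball (c : E) (η / 2)) ⊆ ball (0 : E) (1 + η / 2) := by
    refine Set.iUnion₂_subset fun x hx => ball_subset_ball' ?_
    rw [dist_zero_right]
    linarith [hs x hx]
  have I : (s.card : ENNReal) * ENNReal.ofReal ((η / 2) ^ finrank ℝ E) * μ (ball 0 1) ≤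
      ENNReal.ofReal ((1 + η / 2) ^ finrank ℝ E) * μ (ball 0 1) :=
    calc
      (s.card : ENNReal) * ENNReal.ofReal ((η / 2) ^ finrank ℝ E) * μ (ball 0 1)
          = μ (⋃ c ∈ s, ball (c : E) (η / 2)) := by
        rw [measure_biUnion_finset D fun c _ => measurableSet_ball]
        simp only [μ.addHaar_ball_of_pos _ hδ]
        simp only [Finset.sum_const, nsmul_eq_mul, mul_assoc]
      _ ≤ μ (ball (0 : E) (1 + η / 2)) := measure_mono hsub
      _ = _ := by simp only [μ.addHaar_ball_of_pos _ hρ]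
  have J := (ENNReal.mul_le_mul_iff_left
    (measure_ball_pos _ _ zero_lt_one).ne' measure_ball_lt_top.ne).1 I
  have K := ENNReal.toReal_le_of_le_ofReal (pow_nonneg hρ.le _) J
  rw [ENNReal.toReal_mul, ENNReal.toReal_natCast, ENNReal.toReal_ofReal (by positivity)] at K
  have e : (1 + 2 / η) ^ finrank ℝ E
      = (1 + η / 2) ^ finrank ℝ E / (η / 2) ^ finrank ℝ E := by
    rw [← div_pow]
    congr 1
    field_simp
    ring
  rw [e, le_div_iff₀ (by positivity)]
  exact K

/-- Every subset of the unit ball of a finite-dimensional normed space has a finite `η`-net,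
consisting of points of the subset, whose size is at most exponential in the dimension. -/
lemma exists_finset_net {E : Type*} [NormedAddCommGroup E] [NormedSpace ℝ E]
    [FiniteDimensional ℝ E] {η : ℝ} (hη : 0 < η) (S : Set E) (hS : ∀ x ∈ S, ‖x‖ ≤ 1) :
    ∃ s : Finset E, (∀ x ∈ s, x ∈ S) ∧
      (s.card : ℝ) ≤ (1 + 2 / η) ^ Module.finrank ℝ E ∧ ∀ x ∈ S, ∃ y ∈ s, ‖x - y‖ ≤ η := by
  classical
  let good : Finset E → Prop := fun s =>
    (∀ x ∈ s, x ∈ S) ∧ ∀ c ∈ s, ∀ d ∈ s, c ≠ d → η ≤ ‖c - d‖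
  have hcard : ∀ s, good s → (s.card : ℝ) ≤ (1 + 2 / η) ^ Module.finrank ℝ E := fun s hs =>
    card_le_of_separated_unitBall hη s (fun c hc => hS c (hs.1 c hc)) hs.2
  have hbdd : BddAbove {n : ℕ | ∃ s, good s ∧ s.card = n} := by
    refine ⟨⌈(1 + 2 / η) ^ Module.finrank ℝ E⌉₊, ?_⟩
    rintro n ⟨s, hs, rfl⟩
    exact_mod_cast (hcard s hs).trans (Nat.le_ceil _)
  have hne : {n : ℕ | ∃ s, good s ∧ s.card = n}.Nonempty :=
    ⟨0, ∅, ⟨by simp, by simp⟩, by simp⟩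
  -- The volume bound lets a separated subset of largest cardinality be chosen. Such a set is a net,
  -- since an uncovered point could be added to it.
  obtain ⟨s, hs, hsc⟩ := Nat.sSup_mem hne hbdd
  refine ⟨s, hs.1, hcard s hs, fun x hx => ?_⟩
  by_contra! hcon
  have hxs : x ∉ s := fun hxs => by
    have := hcon x hxs
    simp at this
    linarith
  have hgood : good (insert x s) := by
    refine ⟨?_, ?_⟩
    · intro y hy
      rcases Finset.mem_insert.1 hy with rfl | hy
      · exact hx
      · exact hs.1 y hy
    · intro c hc d hd hcd
      rcases Finset.mem_insert.1 hc with hcx | hc <;> rcases Finset.mem_insert.1 hd with hdx | hd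
      · exact absurd (hcx.trans hdx.symm) hcd
      · rw [hcx]; exact (hcon d hd).le
      · rw [hdx, norm_sub_rev]; exact (hcon c hc).le
      · exact hs.2 c hc d hd hcd
  have := le_csSup hbdd ⟨insert x s, hgood, rfl⟩
  rw [Finset.card_insert_of_notMem hxs, ← hsc] at this
  omega

end Nets

/-! ### Rank-one arrays, operator norm and low-rank arrays -/

section Tensor

variable {ι κ : Type*}

/-- The rank-one array `u_i v_t`. -/
noncomputable def rankOne (u : EuclideanSpace ℝ ι) (v : EuclideanSpace ℝ κ) :
    EuclideanSpace ℝ (ι × κ) :=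
  WithLp.toLp 2 fun q => u q.1 * v q.2

@[simp]
lemma rankOne_apply (u : EuclideanSpace ℝ ι) (v : EuclideanSpace ℝ κ) (q : ι × κ) :
    rankOne u v q = u q.1 * v q.2 := rfl

lemma rankOne_sub_left (u u' : EuclideanSpace ℝ ι) (v : EuclideanSpace ℝ κ) :
    rankOne (u - u') v = rankOne u v - rankOne u' v := by
  ext q; simp [sub_mul]

lemma rankOne_sub_right (u : EuclideanSpace ℝ ι) (v v' : EuclideanSpace ℝ κ) :
    rankOne u (v - v') = rankOne u v - rankOne u v' := by
  ext q; simp [mul_sub]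

lemma rankOne_smul_left (c : ℝ) (u : EuclideanSpace ℝ ι) (v : EuclideanSpace ℝ κ) :
    rankOne (c • u) v = c • rankOne u v := by
  ext q; simp [mul_assoc]

lemma rankOne_smul_right (c : ℝ) (u : EuclideanSpace ℝ ι) (v : EuclideanSpace ℝ κ) :
    rankOne u (c • v) = c • rankOne u v := by
  ext q; simp; ring

lemma continuous_rankOne :
    Continuous fun p : EuclideanSpace ℝ ι × EuclideanSpace ℝ κ => rankOne p.1 p.2 := by
  unfold rankOne
  fun_prop

variable [Fintype ι] [Fintype κ]

lemma norm_rankOne (u : EuclideanSpace ℝ ι) (v : EuclideanSpace ℝ κ) :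
    ‖rankOne u v‖ = ‖u‖ * ‖v‖ := by
  rw [← sq_eq_sq₀ (norm_nonneg _) (by positivity), mul_pow]
  simp only [EuclideanSpace.real_norm_sq_eq, rankOne_apply, Fintype.sum_prod_type, mul_pow,
    Finset.sum_mul_sum]

/-- `z` has operator norm at most `a`, as a bilinear form on the product of the unit balls. -/
def BilinBound (z : EuclideanSpace ℝ (ι × κ)) (a : ℝ) : Prop :=
  ∀ u v, ‖u‖ ≤ 1 → ‖v‖ ≤ 1 → inner ℝ z (rankOne u v) ≤ a

/-- It is enough to control a bilinear form on a `1/4`-net. -/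
lemma bilinBound_of_net (z : EuclideanSpace ℝ (ι × κ)) (m : ℝ)
    (s : Finset (EuclideanSpace ℝ ι × EuclideanSpace ℝ κ))
    (hs : ∀ x ∈ s, ‖x‖ ≤ 1)
    (hnet : ∀ x : EuclideanSpace ℝ ι × EuclideanSpace ℝ κ, ‖x‖ ≤ 1 → ∃ y ∈ s, ‖x - y‖ ≤ 1 / 4)
    (hm : ∀ x ∈ s, inner ℝ z (rankOne x.1 x.2) ≤ m) :
    BilinBound z (2 * m) := by
  have hcont : Continuous fun p : EuclideanSpace ℝ ι × EuclideanSpace ℝ κ =>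
      inner ℝ z (rankOne p.1 p.2) := continuous_const.inner continuous_rankOne
  obtain ⟨⟨u, v⟩, hx, hmax⟩ := (isCompact_closedBall
    (0 : EuclideanSpace ℝ ι × EuclideanSpace ℝ κ) 1).exists_isMaxOn ⟨0, by simp⟩ hcont.continuousOn
  set a := inner ℝ z (rankOne u v) with ha
  have hle : BilinBound z a := fun u' v' hu' hv' =>
    hmax (a := (u', v')) (by simpa using ⟨hu', hv'⟩)
  have hx1 : ‖(u, v)‖ ≤ 1 := by simpa using hx
  obtain ⟨⟨u', v'⟩, hy, hd⟩ := hnet (u, v) hx1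
  have hd1 : ‖u - u'‖ ≤ 1 / 4 := (norm_fst_le ((u, v) - (u', v'))).trans hd
  have hd2 : ‖v - v'‖ ≤ 1 / 4 := (norm_snd_le ((u, v) - (u', v'))).trans hd
  -- Rescaled by 4, each rounding error is back in the unit ball. Replacing the two vectors in turn
  -- costs at most `a/4` each, so `a ≤ m + a/2`.
  have h1 : inner ℝ z (rankOne ((4 : ℝ) • (u - u')) v) ≤ a := by
    refine hle _ _ ?_ ((norm_snd_le (u, v)).trans hx1)
    rw [norm_smul]
    norm_num
    linarith
  have h2 : inner ℝ z (rankOne u' ((4 : ℝ) • (v - v'))) ≤ a := by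
    refine hle _ _ ((norm_fst_le (u', v')).trans (hs _ hy)) ?_
    rw [norm_smul]
    norm_num
    linarith
  have h3 := hm _ hy
  rw [rankOne_smul_left, rankOne_sub_left, inner_smul_right, inner_sub_right] at h1
  rw [rankOne_smul_right, rankOne_sub_right, inner_smul_right, inner_sub_right] at h2
  have : a ≤ 2 * m := by
    simp only at h3
    linarith
  exact fun u' v' hu' hv' => (hle u' v' hu' hv').trans this

lemma BilinBound.abs_le {z : EuclideanSpace ℝ (ι × κ)} {a : ℝ} (h : BilinBound z a)
    {η : ℝ} (hη : 0 < η) {u : EuclideanSpace ℝ ι} {v : EuclideanSpace ℝ κ} {b c : ℝ}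
    (hb : 0 < b) (hc : 0 < c) (hu : ‖u‖ ≤ b) (hv : ‖v‖ ≤ c) (hbc : b * c = η) :
    |inner ℝ z (rankOne u v)| ≤ η * a := by
  have key : ∀ u : EuclideanSpace ℝ ι, ‖u‖ ≤ b → inner ℝ z (rankOne u v) ≤ η * a := by
    intro u hu
    have := h (b⁻¹ • u) (c⁻¹ • v)
      (by rw [norm_smul, norm_inv, Real.norm_of_nonneg hb.le, inv_mul_le_iff₀ hb]; linarith)
      (by rw [norm_smul, norm_inv, Real.norm_of_nonneg hc.le, inv_mul_le_iff₀ hc]; linarith)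
    rw [rankOne_smul_left, rankOne_smul_right, inner_smul_right, inner_smul_right] at this
    have h2 := mul_le_mul_of_nonneg_left this hη.le
    have : η * (b⁻¹ * (c⁻¹ * inner ℝ z (rankOne u v))) = inner ℝ z (rankOne u v) := by
      rw [← hbc]; field_simp
    linarith
  refine _root_.abs_le.2 ⟨?_, key u hu⟩
  have := key ((-1 : ℝ) • u) (by simpa using hu)
  rw [rankOne_smul_left, inner_smul_right] at this
  linarith

/-- The array `∑_j u_{j,i} v_{j,t}` of rank at most `R`. -/
noncomputable def lowRank {R : ℕ} (x : Fin R → EuclideanSpace ℝ ι × EuclideanSpace ℝ κ) :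
    EuclideanSpace ℝ (ι × κ) :=
  ∑ j, rankOne (x j).1 (x j).2

variable {R : ℕ} {x y : Fin R → EuclideanSpace ℝ ι × EuclideanSpace ℝ κ}

-- Changing one vector of each pair at a time leaves `2R` rank-one terms, each containing a small
-- difference.
omit [Fintype ι] [Fintype κ] in
lemma lowRank_sub : lowRank x - lowRank y =
    ∑ j, (rankOne ((x j).1 - (y j).1) (x j).2 + rankOne (y j).1 ((x j).2 - (y j).2)) := by
  unfold lowRank
  rw [← Finset.sum_sub_distrib]
  refine Finset.sum_congr rfl fun j _ => ?_
  rw [rankOne_sub_left, rankOne_sub_right]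
  abel

lemma norm_lowRank_le (hx : ‖x‖ ≤ 1) : ‖lowRank x‖ ≤ R := by
  refine (norm_sum_le _ _).trans ?_
  have : ∀ j ∈ Finset.univ, ‖rankOne (x j).1 (x j).2‖ ≤ 1 := by
    intro j _
    have hj := (norm_le_pi_norm x j).trans hx
    rw [norm_rankOne]
    exact mul_le_one₀ ((norm_fst_le _).trans hj) (norm_nonneg _) ((norm_snd_le _).trans hj)
  simpa using Finset.sum_le_sum this

lemma norm_lowRank_sub_le {η : ℝ} (hx : ‖x‖ ≤ 1) (hy : ‖y‖ ≤ 1) (hxy : ‖x - y‖ ≤ η) :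
    ‖lowRank x - lowRank y‖ ≤ 2 * R * η := by
  rw [lowRank_sub]
  refine (norm_sum_le _ _).trans ?_
  have : ∀ j ∈ Finset.univ, ‖rankOne ((x j).1 - (y j).1) (x j).2
      + rankOne (y j).1 ((x j).2 - (y j).2)‖ ≤ 2 * η := by
    intro j _
    have hxj := (norm_snd_le _).trans ((norm_le_pi_norm x j).trans hx)
    have hyj := (norm_fst_le _).trans ((norm_le_pi_norm y j).trans hy)
    have hd := (norm_le_pi_norm (x - y) j).trans hxy
    have h1 : ‖(x j).1 - (y j).1‖ ≤ η := (norm_fst_le ((x - y) j)).trans hd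
    have h2 : ‖(x j).2 - (y j).2‖ ≤ η := (norm_snd_le ((x - y) j)).trans hd
    refine (norm_add_le _ _).trans ?_
    rw [norm_rankOne, norm_rankOne]
    nlinarith [norm_nonneg ((x j).1 - (y j).1), norm_nonneg ((x j).2 - (y j).2)]
  refine (Finset.sum_le_sum this).trans (le_of_eq ?_)
  simp
  ring

/-- Each of the `2R` telescoped terms pairs with `z` to at most `η a`. Cauchy–Schwarz would bring in
the Frobenius norm of `z`, which for noise is of order `√(N T)`, too large here. -/
lemma BilinBound.abs_inner_lowRank_sub_le {z : EuclideanSpace ℝ (ι × κ)} {a : ℝ}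
    (h : BilinBound z a) {η : ℝ} (hη : 0 < η) (hx : ‖x‖ ≤ 1) (hy : ‖y‖ ≤ 1)
    (hxy : ‖x - y‖ ≤ η) :
    |inner ℝ z (lowRank x - lowRank y)| ≤ 2 * R * η * a := by
  rw [lowRank_sub, inner_sum]
  refine (Finset.abs_sum_le_sum_abs _ _).trans ?_
  have : ∀ j ∈ Finset.univ, |inner ℝ z (rankOne ((x j).1 - (y j).1) (x j).2
      + rankOne (y j).1 ((x j).2 - (y j).2))| ≤ 2 * (η * a) := by
    intro j _
    have hxj := (norm_snd_le _).trans ((norm_le_pi_norm x j).trans hx)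
    have hyj := (norm_fst_le _).trans ((norm_le_pi_norm y j).trans hy)
    have hd := (norm_le_pi_norm (x - y) j).trans hxy
    have h1 : ‖(x j).1 - (y j).1‖ ≤ η := (norm_fst_le ((x - y) j)).trans hd
    have h2 : ‖(x j).2 - (y j).2‖ ≤ η := (norm_snd_le ((x - y) j)).trans hd
    rw [inner_add_right]
    refine (abs_add_le _ _).trans ?_
    have e1 := h.abs_le hη hη one_pos h1 hxj (mul_one η)
    have e2 := h.abs_le hη one_pos hη hyj h2 (one_mul η)
    linarith
  refine (Finset.sum_le_sum this).trans (le_of_eq ?_)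
  simp
  ring

end Tensor

/-! ### Concentration of sums and of random matrices -/

section SubGaussian

variable {Ω : Type*} [MeasurableSpace Ω] {P : Measure Ω}

/-- Hoeffding's inequality, with an upper bound for the sum of the parameters. -/
lemma measureReal_sum_ge_le_of_subgaussian {α : Type*} [Fintype α]
    {Z : α → Ω → ℝ} (hind : iIndepFun Z P) {c : α → NNReal}
    (hZ : ∀ q, HasSubgaussianMGF (Z q) (c q) P) {σ : ℝ} (hσ : ∑ q, (c q : ℝ) ≤ σ)
    {e : ℝ} (he : 0 ≤ e) :
    P.real {ω | e ≤ ∑ q, Z q ω} ≤ Real.exp (-e ^ 2 / (2 * σ)) := by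
  have h := HasSubgaussianMGF.sum_of_iIndepFun hind (s := Finset.univ) (fun q _ => hZ q)
  have hσ0 : 0 ≤ σ := le_trans (by positivity) hσ
  have h' : HasSubgaussianMGF (fun ω => ∑ q, Z q ω) σ.toNNReal P := by
    refine ⟨h.integrable_exp_mul, fun t => (h.mgf_le t).trans ?_⟩
    rw [Real.exp_le_exp, Real.coe_toNNReal _ hσ0]
    push_cast
    gcongr
  have := h'.measure_ge_le he
  rwa [Real.coe_toNNReal _ hσ0] at this

/-- The operator norm of a random matrix with independent sub-Gaussian entries. -/
lemma measureReal_not_bilinBound_le {ι κ : Type*} [Fintype ι] [Fintype κ]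
    {Z : ι × κ → Ω → ℝ} (hind : iIndepFun Z P) (hZ : ∀ q, HasSubgaussianMGF (Z q) 1 P)
    {m : ℝ} (hm : 0 ≤ m) :
    P.real {ω | ¬ BilinBound (WithLp.toLp 2 fun q => Z q ω) (2 * m)} ≤
      9 ^ (Fintype.card ι + Fintype.card κ) * Real.exp (-m ^ 2 / 2) := by
  have := hind.isProbabilityMeasure
  -- Mesh `1/4` gives the base `1 + 2/(1/4) = 9`.
  obtain ⟨s, hs, hcard, hnet⟩ := exists_finset_net (E := EuclideanSpace ℝ ι × EuclideanSpace ℝ κ)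
    (η := 1 / 4) (by norm_num) {x | ‖x‖ ≤ 1} (fun x hx => hx)
  have hdim : Module.finrank ℝ (EuclideanSpace ℝ ι × EuclideanSpace ℝ κ)
      = Fintype.card ι + Fintype.card κ := by
    rw [Module.finrank_prod, finrank_euclideanSpace, finrank_euclideanSpace]
  rw [hdim] at hcard
  norm_num at hcard
  have hsub : {ω | ¬ BilinBound (WithLp.toLp 2 fun q => Z q ω) (2 * m)} ⊆
      ⋃ x ∈ s, {ω | m ≤ ∑ q, (x.1 q.1 * x.2 q.2) * Z q ω} := by
    intro ω hω
    by_contra hcon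
    simp only [Set.mem_iUnion, Set.mem_ofPred_eq, not_exists, not_le] at hcon
    refine hω (bilinBound_of_net _ m s hs hnet fun x hx => ?_)
    have := (hcon x hx).le
    simpa [PiLp.inner_apply] using this
  refine (measureReal_mono hsub (measure_ne_top _ _)).trans ?_
  refine (measureReal_biUnion_finset_le _ _).trans ?_
  have hone : ∀ x ∈ s, P.real {ω | m ≤ ∑ q : ι × κ, (x.1 q.1 * x.2 q.2) * Z q ω}
      ≤ Real.exp (-m ^ 2 / 2) := by
    intro x hx
    have hind' : iIndepFun (fun (q : ι × κ) ω => (x.1 q.1 * x.2 q.2) * Z q ω) P :=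
      hind.comp (fun q z => (x.1 q.1 * x.2 q.2) * z) (fun q => by fun_prop)
    have := measureReal_sum_ge_le_of_subgaussian hind' (fun q => (hZ q).const_mul _) (σ := 1) ?_ hm
    · simpa using this
    · have hx1 : ‖x‖ ≤ 1 := hs x hx
      have h1 : ‖rankOne x.1 x.2‖ ≤ 1 := by
        rw [norm_rankOne]
        exact mul_le_one₀ ((norm_fst_le _).trans hx1) (norm_nonneg _) ((norm_snd_le _).trans hx1)
      have h2 : ‖rankOne x.1 x.2‖ ^ 2 ≤ 1 := pow_le_one₀ (norm_nonneg _) h1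
      rw [EuclideanSpace.real_norm_sq_eq] at h2
      refine le_trans (le_of_eq (Finset.sum_congr rfl fun q _ => ?_)) h2
      exact mul_one ((x.1 q.1 * x.2 q.2) ^ 2)
  refine (Finset.sum_le_sum hone).trans ?_
  rw [Finset.sum_const, nsmul_eq_mul]
  gcongr

end SubGaussian

/-! ### The check loss: convexity, curvature in mean, quantiles -/

section CheckLoss

/-- The derivative of `c ↦ ρ_τ(x - c)`. -/
noncomputable def checkGrad (τ x c : ℝ) : ℝ := (if x ≤ c then 1 else 0) - τ

lemma checkLoss_subgradient (τ x c c' : ℝ) :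
    checkLoss τ (x - c) + checkGrad τ x c * (c' - c) ≤ checkLoss τ (x - c') := by
  unfold checkLoss checkGrad
  split_ifs <;> nlinarith

lemma abs_checkGrad_le {τ : ℝ} (h0 : 0 ≤ τ) (h1 : τ ≤ 1) (x c : ℝ) : |checkGrad τ x c| ≤ 1 := by
  unfold checkGrad
  rw [abs_le]
  split_ifs <;> constructor <;> linarith

lemma abs_checkLoss_sub_le {τ : ℝ} (h0 : 0 ≤ τ) (h1 : τ ≤ 1) (x c d : ℝ) :
    |checkLoss τ (x - (c + d)) - checkLoss τ (x - c)| ≤ |d| := by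
  have hmul : ∀ a : ℝ, |a| ≤ 1 → |a * d| ≤ |d| := fun a ha => by
    rw [abs_mul]
    exact mul_le_of_le_one_left (abs_nonneg d) ha
  have e1 := checkLoss_subgradient τ x c (c + d)
  have e2 := checkLoss_subgradient τ x (c + d) c
  have b1 := abs_le.1 (hmul _ (abs_checkGrad_le h0 h1 x c))
  have b2 := abs_le.1 (hmul _ (abs_checkGrad_le h0 h1 x (c + d)))
  rw [abs_le]
  have s1 : c + d - c = d := by ring
  have s2 : c - (c + d) = -d := by ring
  rw [s1] at e1
  rw [s2] at e2
  constructor <;> linarith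

/-- Convexity: the subgradient inequalities from `q + s * d` to the two endpoints, weighted by `s`
and `1 - s`, have cancelling linear terms. -/
lemma checkLoss_ray (τ x q d s : ℝ) (h0 : 0 ≤ s) (h1 : s ≤ 1) :
    checkLoss τ (x - (q + s * d)) - checkLoss τ (x - q) ≤
      s * (checkLoss τ (x - (q + d)) - checkLoss τ (x - q)) := by
  have e1 := mul_le_mul_of_nonneg_left (checkLoss_subgradient τ x (q + s * d) (q + d)) h0
  have e2 := mul_le_mul_of_nonneg_left (checkLoss_subgradient τ x (q + s * d) q) (sub_nonneg.2 h1)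
  linarith

/-- A lower bound for the loss, in the spirit of Knight's identity. -/
lemma checkLoss_sub_lower (τ x q d : ℝ) :
    checkGrad τ x q * d + |d| / 2 * (Set.uIoc q (q + d / 2)).indicator 1 x ≤
      checkLoss τ (x - (q + d)) - checkLoss τ (x - q) := by
  -- For such `x` the kink has been crossed with at least `|d|/2` of the shift still to go, so the
  -- loss exceeds its tangent by that amount.
  by_cases hx : x ∈ Set.uIoc q (q + d / 2)
  · rw [Set.indicator_of_mem hx, Pi.one_apply, mul_one]
    rcases le_total 0 d with hd | hd
    · rw [Set.uIoc_of_le (by linarith)] at hx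
      unfold checkLoss checkGrad
      rw [abs_of_nonneg hd, if_neg (by linarith [hx.1]), if_pos (by linarith [hx.2]),
        if_neg (by linarith [hx.1])]
      linarith [hx.2]
    · rw [Set.uIoc_of_ge (by linarith)] at hx
      unfold checkLoss checkGrad
      rw [abs_of_nonpos hd, if_pos (by linarith [hx.2]), if_neg (by linarith [hx.1]),
        if_pos (by linarith [hx.2])]
      linarith [hx.1]
  · rw [Set.indicator_of_notMem hx]
    have := checkLoss_subgradient τ x q (q + d)
    have s1 : q + d - q = d := by ring
    rw [s1] at this
    linarith

@[fun_prop]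
lemma measurable_checkLoss (τ : ℝ) : Measurable (checkLoss τ) := by
  unfold checkLoss
  exact (measurable_const.sub
    (Measurable.ite measurableSet_Iic measurable_const measurable_const)).mul measurable_id

@[fun_prop]
lemma measurable_checkGrad (τ c : ℝ) : Measurable fun x => checkGrad τ x c := by
  unfold checkGrad
  exact (Measurable.ite measurableSet_Iic measurable_const measurable_const).sub measurable_const

/-- The law `ν` has `τ`-quantile `q`, and a density between `cl` and `ch` in the `B`-neighbourhood
of `q`. -/
structure RegularQuantile (ν : Measure ℝ) (τ q B cl ch : ℝ) : Prop where
  measure_Iic : ν.real (Set.Iic q) = τ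
  lower : ∀ d, |d| ≤ B → cl * |d| ≤ ν.real (Set.uIoc q (q + d))
  upper : ∀ d, |d| ≤ B → ν.real (Set.uIoc q (q + d)) ≤ ch * |d|

variable {ν : Measure ℝ} [IsProbabilityMeasure ν] {τ q B cl ch : ℝ}

lemma integral_checkGrad (c : ℝ) : ∫ x, checkGrad τ x c ∂ν = ν.real (Set.Iic c) - τ := by
  have h : (fun x => checkGrad τ x c) = fun x => (Set.Iic c).indicator 1 x - τ := by
    ext x
    simp [checkGrad, Set.indicator_apply]
  have hi : Integrable ((Set.Iic c).indicator (1 : ℝ → ℝ)) ν :=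
    (integrable_indicator_iff measurableSet_Iic).2 (integrable_const (1 : ℝ)).integrableOn
  rw [h, integral_sub hi (integrable_const _), integral_indicator_one measurableSet_Iic]
  simp

/-- The mean gradient vanishes at the quantile, so at `q + d` it is, up to sign, the mass between
`q` and `q + d`. -/
lemma RegularQuantile.abs_integral_checkGrad_le (h : RegularQuantile ν τ q B cl ch) {d : ℝ}
    (hd : |d| ≤ B) : |∫ x, checkGrad τ x (q + d) ∂ν| ≤ ch * |d| := by
  rw [integral_checkGrad, ← h.measure_Iic]
  refine le_trans ?_ (h.upper d hd)
  rcases le_total 0 d with h0 | h0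
  · have hu : Set.Iic (q + d) = Set.Iic q ∪ Set.Ioc q (q + d) :=
      (Set.Iic_union_Ioc_eq_Iic (by linarith)).symm
    rw [hu, measureReal_union (Set.Iic_disjoint_Ioc le_rfl) measurableSet_Ioc,
      Set.uIoc_of_le (by linarith), add_sub_cancel_left, abs_of_nonneg measureReal_nonneg]
  · have hu : Set.Iic q = Set.Iic (q + d) ∪ Set.Ioc (q + d) q :=
      (Set.Iic_union_Ioc_eq_Iic (by linarith)).symm
    rw [hu, measureReal_union (Set.Iic_disjoint_Ioc le_rfl) measurableSet_Ioc,
      Set.uIoc_of_ge (by linarith), sub_add_cancel_left, abs_neg, abs_of_nonneg measureReal_nonneg]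

omit [IsProbabilityMeasure ν] in
lemma integrable_of_abs_le [IsFiniteMeasure ν] {f : ℝ → ℝ} (hf : Measurable f) {b : ℝ}
    (hb : ∀ x, |f x| ≤ b) : Integrable f ν :=
  Integrable.of_bound hf.aestronglyMeasurable b (Eventually.of_forall hb)

/-- In the Knight-type bound the linear term has mean zero. What remains is `|d|/2` times a mass of
at least `cl * |d|/2`. -/
lemma RegularQuantile.le_integral_checkLoss (h : RegularQuantile ν τ q B cl ch)
    (h0 : 0 ≤ τ) (h1 : τ ≤ 1) {d : ℝ} (hd : |d| ≤ B) :
    cl / 4 * d ^ 2 ≤ ∫ x, (checkLoss τ (x - (q + d)) - checkLoss τ (x - q)) ∂ν := by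
  have hm : MeasurableSet (Set.uIoc q (q + d / 2)) := measurableSet_uIoc
  have hi1 : Integrable (fun x => checkGrad τ x q * d) ν :=
    (integrable_of_abs_le (measurable_checkGrad τ q) (abs_checkGrad_le h0 h1 · q)).mul_const d
  have hi2 : Integrable (fun x => |d| / 2 * (Set.uIoc q (q + d / 2)).indicator (1 : ℝ → ℝ) x) ν :=
    ((integrable_indicator_iff hm).2 (integrable_const (1 : ℝ)).integrableOn).const_mul _
  have hi3 : Integrable (fun x => checkLoss τ (x - (q + d)) - checkLoss τ (x - q)) ν :=
    integrable_of_abs_le (by fun_prop) (abs_checkLoss_sub_le h0 h1 · q d)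
  have key := integral_mono (hi1.add hi2) hi3 fun x => checkLoss_sub_lower τ x q d
  refine le_trans ?_ key
  have e : ∫ x, ((fun x => checkGrad τ x q * d) + fun x =>
      |d| / 2 * (Set.uIoc q (q + d / 2)).indicator (1 : ℝ → ℝ) x) x ∂ν
      = |d| / 2 * ν.real (Set.uIoc q (q + d / 2)) := by
    simp only [Pi.add_apply]
    rw [integral_add hi1 hi2, integral_mul_const, integral_checkGrad, h.measure_Iic,
      integral_const_mul, integral_indicator_one hm]
    simp
  rw [e]
  have hd2 : |d / 2| = |d| / 2 := by rw [abs_div]; norm_num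
  have := h.lower (d / 2) (by rw [hd2]; linarith [abs_nonneg d])
  rw [hd2] at this
  calc cl / 4 * d ^ 2 = |d| / 2 * (cl * (|d| / 2)) := by rw [← sq_abs d]; ring
    _ ≤ _ := by gcongr

/-- The quantile of a law without atoms. -/
lemma measureReal_Iic_of_quantile_eq [NullSingletonClass ν] (h0 : 0 < τ) (h1 : τ < 1)
    (hq : quantile ν τ = q) : ν.real (Set.Iic q) = τ := by
  rw [← cdf_eq_real]
  set S := {x : ℝ | τ ≤ cdf ν x} with hS
  have hne : S.Nonempty := by
    obtain ⟨x, hx⟩ := ((tendsto_cdf_atTop ν).eventually (lt_mem_nhds h1)).exists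
    exact ⟨x, hx.le⟩
  have hbdd : BddBelow S := by
    obtain ⟨x, hx⟩ := ((tendsto_cdf_atBot ν).eventually (gt_mem_nhds h0)).exists
    refine ⟨x, fun y hy => ?_⟩
    by_contra! hcon
    have := (cdf ν).mono hcon.le
    have hy' : τ ≤ cdf ν y := hy
    linarith
  have hinf : sInf S = q := hq
  apply le_antisymm
  -- Without an atom at `q`, the cdf there is at most its left limit, and to the left of the infimum
  -- it is below `τ`. Right continuity gives the other inequality.
  · have hsing := (cdf ν).measure_singleton q
    rw [measure_cdf, measure_singleton, eq_comm, ENNReal.ofReal_eq_zero] at hsing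
    have hleft : Function.leftLim (cdf ν) q ≤ τ := by
      refine le_of_tendsto ((cdf ν).mono.tendsto_leftLim q) ?_
      filter_upwards [self_mem_nhdsWithin] with x hx
      by_contra! hcon
      have := csInf_le hbdd (show x ∈ S from hcon.le)
      rw [hinf] at this
      exact absurd this (not_le.2 hx)
    linarith
  · have hr : Tendsto (cdf ν) (𝓝[>] q) (𝓝 (cdf ν q)) :=
      ((cdf ν).right_continuous q).mono_left (nhdsWithin_mono _ Set.Ioi_subset_Ici_self)
    refine ge_of_tendsto hr ?_
    filter_upwards [self_mem_nhdsWithin] with x hx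
    obtain ⟨y, hy, hyx⟩ := exists_lt_of_csInf_lt hne (by rw [hinf]; exact hx)
    exact le_trans hy ((cdf ν).mono hyx.le)

lemma regularQuantile_of_density {g : ℝ → ℝ} (hg : IsDensityOf g ν) (h0 : 0 < τ) (h1 : τ < 1)
    (hq : quantile ν τ = q) {B₀ : ℝ} (hqB : |q| ≤ B₀) (hcl : 0 ≤ cl)
    (hlo : ∀ x ∈ Set.Icc (-(B₀ + B)) (B₀ + B), cl ≤ g x)
    (hhi : ∀ x ∈ Set.Icc (-(B₀ + B)) (B₀ + B), g x ≤ ch) :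
    RegularQuantile ν τ q B cl ch := by
  obtain ⟨hgm, hg0, hgν⟩ := hg
  have : NullSingletonClass ν := by rw [hgν]; infer_instance
  have hsub : ∀ d, |d| ≤ B → ∀ x ∈ Set.uIoc q (q + d), x ∈ Set.Icc (-(B₀ + B)) (B₀ + B) := by
    intro d hd x hx
    have hd' := abs_le.1 hd
    have hq' := abs_le.1 hqB
    rcases Set.mem_uIoc.1 hx with hx | hx <;> constructor <;> linarith [hx.1, hx.2, abs_nonneg d]
  have hmeas : ∀ d, ν (Set.uIoc q (q + d)) = ∫⁻ x in Set.uIoc q (q + d), ENNReal.ofReal (g x) := by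
    intro d
    conv_lhs => rw [hgν]
    rw [withDensity_apply _ measurableSet_uIoc]
  have hvol : ∀ d, volume (Set.uIoc q (q + d)) = ENNReal.ofReal |d| := by
    intro d
    rw [Real.volume_uIoc, add_sub_cancel_left]
  refine ⟨measureReal_Iic_of_quantile_eq h0 h1 hq, fun d hd => ?_, fun d hd => ?_⟩
  · rw [measureReal_def, ← ENNReal.ofReal_le_iff_le_toReal (measure_ne_top _ _), hmeas,
      ENNReal.ofReal_mul hcl, ← hvol, ← setLIntegral_const]
    exact setLIntegral_mono' measurableSet_uIoc fun x hx =>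
      ENNReal.ofReal_le_ofReal (hlo x (hsub d hd x hx))
  · have hB : 0 ≤ B := (abs_nonneg d).trans hd
    have hch : 0 ≤ ch := (hg0 q).trans (hhi q (by
      have := abs_le.1 hqB
      constructor <;> linarith))
    refine ENNReal.toReal_le_of_le_ofReal (by positivity) ?_
    rw [hmeas, ENNReal.ofReal_mul hch, ← hvol, ← setLIntegral_const]
    exact setLIntegral_mono' measurableSet_uIoc fun x hx =>
      ENNReal.ofReal_le_ofReal (hhi x (hsub d hd x hx))

end CheckLoss

/-! ### The excess loss and its transfer from a net -/

section Excess

variable {α : Type*} [Fintype α]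

/-- The increase of the loss when the true quantiles `q₀` are shifted by `d`. -/
noncomputable def excessLoss (τ : ℝ) (q₀ x : α → ℝ) (d : EuclideanSpace ℝ α) : ℝ :=
  ∑ q, (checkLoss τ (x q - (q₀ q + d q)) - checkLoss τ (x q - q₀ q))

/-- The gradient of the loss at the true quantiles `q₀` shifted by `d`. -/
noncomputable def lossGrad (τ : ℝ) (q₀ x : α → ℝ) (d : EuclideanSpace ℝ α) :
    EuclideanSpace ℝ α :=
  WithLp.toLp 2 fun q => checkGrad τ (x q) (q₀ q + d q)

lemma excessLoss_subgradient (τ : ℝ) (q₀ x : α → ℝ) (d d' : EuclideanSpace ℝ α) :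
    excessLoss τ q₀ x d + inner ℝ (lossGrad τ q₀ x d) (d' - d) ≤ excessLoss τ q₀ x d' := by
  simp only [excessLoss, PiLp.inner_apply, lossGrad, ← Finset.sum_add_distrib]
  refine Finset.sum_le_sum fun q _ => ?_
  have := checkLoss_subgradient τ (x q) (q₀ q + d q) (q₀ q + d' q)
  simp only [PiLp.sub_apply, RCLike.inner_apply, conj_trivial]
  have e : q₀ q + d' q - (q₀ q + d q) = d' q - d q := by ring
  rw [e] at this
  linarith

lemma excessLoss_ray (τ : ℝ) (q₀ x : α → ℝ) (d : EuclideanSpace ℝ α) {s : ℝ} (h0 : 0 ≤ s)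
    (h1 : s ≤ 1) : excessLoss τ q₀ x (s • d) ≤ s * excessLoss τ q₀ x d := by
  simp only [excessLoss, Finset.mul_sum]
  exact Finset.sum_le_sum fun q _ => checkLoss_ray τ (x q) (q₀ q) (d q) s h0 h1

variable {ι κ : Type*} [Fintype ι] [Fintype κ]

/-- The lower bound for the excess loss is transferred from the points of a net. -/
lemma excessLoss_lower_of_near {R : ℕ} {x y : Fin R → EuclideanSpace ℝ ι × EuclideanSpace ℝ κ}
    (hx : ‖x‖ ≤ 1) (hy : ‖y‖ ≤ 1) {η : ℝ} (hη : 0 < η) (hxy : ‖x - y‖ ≤ η)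
    {τ : ℝ} {q₀ w : ι × κ → ℝ} {δ c ch m e : ℝ} (hδ : 0 ≤ δ) (hc : 0 ≤ c) (hch : 0 ≤ ch)
    {gbar : EuclideanSpace ℝ (ι × κ)} (hg : ‖gbar‖ ≤ ch * ‖δ • lowRank y‖)
    (hz : BilinBound (lossGrad τ q₀ w (δ • lowRank y) - gbar) (2 * m))
    (he : c * ‖δ • lowRank y‖ ^ 2 - e ≤ excessLoss τ q₀ w (δ • lowRank y)) :
    c * ‖δ • lowRank x‖ ^ 2 - (e + (2 * ch + 4 * c) * R ^ 2 * η * δ ^ 2 + 4 * R * η * m * δ) ≤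
      excessLoss τ q₀ w (δ • lowRank x) := by
  have h1 := excessLoss_subgradient τ q₀ w (δ • lowRank y) (δ • lowRank x)
  set g := lossGrad τ q₀ w (δ • lowRank y) with hgdef
  have hnx := norm_lowRank_le hx
  have hny := norm_lowRank_le hy
  have hsub := norm_lowRank_sub_le hx hy hxy
  -- The noise part `g - gbar` is paired through its operator norm, the mean part `gbar` through
  -- Cauchy–Schwarz, as its Frobenius norm is only of order `δ`.
  have hsplit : inner ℝ g (δ • lowRank x - δ • lowRank y)
      = δ * inner ℝ (g - gbar) (lowRank x - lowRank y)
        + δ * inner ℝ gbar (lowRank x - lowRank y) := by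
    rw [← smul_sub, inner_smul_right, ← mul_add, ← inner_add_left, sub_add_cancel]
  have hb1 := neg_le_of_abs_le (hz.abs_inner_lowRank_sub_le hη hx hy hxy)
  have hb2 := neg_le_of_abs_le (abs_real_inner_le_norm gbar (lowRank x - lowRank y))
  have hR : (0 : ℝ) ≤ R := Nat.cast_nonneg R
  have hb3 : ‖gbar‖ * ‖lowRank x - lowRank y‖ ≤ (ch * (δ * R)) * (2 * R * η) := by
    gcongr
    refine hg.trans ?_
    rw [norm_smul, Real.norm_of_nonneg hδ]
    gcongr
  have hb4 : ‖δ • lowRank x‖ ^ 2 - ‖δ • lowRank y‖ ^ 2 ≤ 4 * R ^ 2 * η * δ ^ 2 := by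
    rw [norm_smul, norm_smul, Real.norm_of_nonneg hδ, mul_pow, mul_pow, ← mul_sub, mul_comm _ (δ ^ 2)]
    refine mul_le_mul_of_nonneg_left ?_ (sq_nonneg δ)
    have t : ‖lowRank x‖ - ‖lowRank y‖ ≤ 2 * R * η := (norm_sub_norm_le _ _).trans hsub
    calc ‖lowRank x‖ ^ 2 - ‖lowRank y‖ ^ 2
        = (‖lowRank x‖ - ‖lowRank y‖) * (‖lowRank x‖ + ‖lowRank y‖) := by ring
      _ ≤ (2 * R * η) * (R + R) := by
        gcongr
      _ = 4 * R ^ 2 * η := by ring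
  have hb5 := mul_le_mul_of_nonneg_left hb4 hc
  have hb6 := mul_le_mul_of_nonneg_left hb1 hδ
  have hb7 := mul_le_mul_of_nonneg_left (neg_le_neg hb3 |>.trans hb2) hδ
  rw [hsplit] at h1
  nlinarith

end Excess

/-! ### Uniform lower bound for the excess loss in a ball -/

section Probability

variable {Ω : Type*} [MeasurableSpace Ω] {P : Measure Ω} [IsProbabilityMeasure P]

section Pointwise

variable {α : Type*} [Fintype α] {X : α → Ω → ℝ} {τ : ℝ} {q₀ : α → ℝ} {B cl ch : ℝ}

/-- The lower bound for the excess loss at a given shift. -/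
lemma measureReal_excessLoss_lt_le (hX : ∀ q, Measurable (X q)) (hind : iIndepFun X P)
    (h0 : 0 ≤ τ) (h1 : τ ≤ 1)
    (hreg : ∀ q, RegularQuantile (P.map (X q)) τ (q₀ q) B cl ch)
    {d : EuclideanSpace ℝ α} (hd : ∀ q, |d q| ≤ B) {σ e : ℝ} (hσ : ‖d‖ ^ 2 ≤ σ) (he : 0 ≤ e) :
    P.real {ω | excessLoss τ q₀ (fun q => X q ω) d < cl / 4 * ‖d‖ ^ 2 - e} ≤
      Real.exp (-e ^ 2 / (2 * σ)) := by
  let f : α → ℝ → ℝ := fun q x => checkLoss τ (x - (q₀ q + d q)) - checkLoss τ (x - q₀ q)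
  have hf : ∀ q, Measurable (f q) := fun q => by fun_prop
  -- The loss is 1-Lipschitz, so each increment lies in `[-|d q|, |d q|]` and the variance proxies
  -- add up to `‖d‖ ^ 2`.
  have hW : ∀ q, HasSubgaussianMGF (fun ω => -(f q (X q ω) - ∫ ω, f q (X q ω) ∂P))
      ((‖|d q| - -|d q|‖₊ / 2) ^ 2) P := fun q =>
    (hasSubgaussianMGF_of_mem_Icc ((hf q).comp (hX q)).aemeasurable
      (Eventually.of_forall fun ω => abs_le.1 (abs_checkLoss_sub_le h0 h1 (X q ω) (q₀ q) (d q)))).neg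
  have hind' : iIndepFun (fun q ω => -(f q (X q ω) - ∫ ω, f q (X q ω) ∂P)) P :=
    hind.comp (fun q x => -(f q x - ∫ ω, f q (X q ω) ∂P)) (fun q => ((hf q).sub_const _).neg)
  have hsum : ∑ q, (((‖|d q| - -|d q|‖₊ / 2) ^ 2 : NNReal) : ℝ) ≤ σ := by
    refine le_trans (le_of_eq ?_) hσ
    rw [EuclideanSpace.real_norm_sq_eq]
    refine Finset.sum_congr rfl fun q _ => ?_
    rw [NNReal.coe_pow, NNReal.coe_div, coe_nnnorm, Real.norm_of_nonneg (by
      linarith [abs_nonneg (d q)]), ← sq_abs (d q)]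
    simp
  refine le_trans (measureReal_mono ?_ (measure_ne_top _ _))
    (measureReal_sum_ge_le_of_subgaussian hind' hW hsum he)
  intro ω hω
  have hω' : ∑ q, f q (X q ω) < cl / 4 * ‖d‖ ^ 2 - e := hω
  have hmean : cl / 4 * ‖d‖ ^ 2 ≤ ∑ q, ∫ ω, f q (X q ω) ∂P := by
    rw [EuclideanSpace.real_norm_sq_eq, Finset.mul_sum]
    refine Finset.sum_le_sum fun q _ => ?_
    have : IsProbabilityMeasure (P.map (X q)) := Measure.isProbabilityMeasure_map (hX q).aemeasurable
    have := (hreg q).le_integral_checkLoss h0 h1 (hd q)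
    rwa [integral_map (hX q).aemeasurable (hf q).aestronglyMeasurable] at this
  show e ≤ ∑ q, -(f q (X q ω) - ∫ ω, f q (X q ω) ∂P)
  rw [Finset.sum_neg_distrib, Finset.sum_sub_distrib]
  linarith

omit [Fintype α] in
lemma hasSubgaussianMGF_checkGrad (hX : ∀ q, Measurable (X q)) (h0 : 0 ≤ τ) (h1 : τ ≤ 1)
    (c : ℝ) (q : α) :
    HasSubgaussianMGF (fun ω => checkGrad τ (X q ω) c - ∫ ω, checkGrad τ (X q ω) c ∂P) 1 P := by
  have := hasSubgaussianMGF_of_mem_Icc (a := -1) (b := 1) (μ := P)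
    ((measurable_checkGrad τ c).comp (hX q)).aemeasurable
    (Eventually.of_forall fun ω => abs_le.1 (abs_checkGrad_le h0 h1 (X q ω) c))
  have e : ((‖(1 : ℝ) - -1‖₊ / 2) ^ 2 : NNReal) = 1 := by
    rw [← NNReal.coe_inj]
    push_cast
    norm_num
  rwa [e] at this

/-- The mean of the gradient is of the order of the shift. -/
lemma norm_integral_checkGrad_le (hX : ∀ q, Measurable (X q)) (hch : 0 ≤ ch)
    (hreg : ∀ q, RegularQuantile (P.map (X q)) τ (q₀ q) B cl ch)
    {d : EuclideanSpace ℝ α} (hd : ∀ q, |d q| ≤ B) :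
    ‖(WithLp.toLp 2 fun q => ∫ ω, checkGrad τ (X q ω) (q₀ q + d q) ∂P : EuclideanSpace ℝ α)‖ ≤
      ch * ‖d‖ := by
  rw [← sq_le_sq₀ (norm_nonneg _) (by positivity), mul_pow, EuclideanSpace.real_norm_sq_eq,
    EuclideanSpace.real_norm_sq_eq, Finset.mul_sum]
  refine Finset.sum_le_sum fun q _ => ?_
  have : IsProbabilityMeasure (P.map (X q)) := Measure.isProbabilityMeasure_map (hX q).aemeasurable
  have := (hreg q).abs_integral_checkGrad_le (hd q)
  rw [integral_map (hX q).aemeasurable (measurable_checkGrad τ _).aestronglyMeasurable] at this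
  rw [← mul_pow, sq_le_sq, abs_mul, abs_of_nonneg hch]
  exact this

end Pointwise

/-- Uniform lower bound for the excess loss over shifts of rank at most `R` and Frobenius norm at
most `δ`, where `δ ^ 2` is at least of the order of the number of parameters. -/
theorem exists_measureReal_excessLoss_lt_le (R : ℕ) (B : ℝ) {cl ch ε : ℝ} (hcl : 0 ≤ cl)
    (hch : 0 ≤ ch) (hε : 0 < ε) :
    ∃ C > 0, ∀ {ι κ : Type} [Fintype ι] [Fintype κ] {X : ι × κ → Ω → ℝ} {τ : ℝ} {q₀ : ι × κ → ℝ}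
      {δ : ℝ}, (∀ q, Measurable (X q)) → iIndepFun X P → 0 ≤ τ → τ ≤ 1 →
      (∀ q, RegularQuantile (P.map (X q)) τ (q₀ q) B cl ch) → 0 < δ →
      C * (Fintype.card ι + Fintype.card κ : ℕ) ≤ δ ^ 2 →
      P.real {ω | ∃ x : Fin R → EuclideanSpace ℝ ι × EuclideanSpace ℝ κ, ‖x‖ ≤ 1 ∧
        (∀ q, |(δ • lowRank x) q| ≤ B) ∧
        excessLoss τ q₀ (fun q => X q ω) (δ • lowRank x) <
          cl / 4 * ‖δ • lowRank x‖ ^ 2 - ε * δ ^ 2} ≤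
      2 * Real.exp (-(Fintype.card ι + Fintype.card κ : ℕ)) := by
  set R' : ℝ := (R : ℝ) + 1 with hR'
  have hR'0 : 0 < R' := by positivity
  have hRR' : (R : ℝ) ≤ R' := by linarith
  -- The mesh does not depend on the array size. It makes the deterministic transfer error at most
  -- `ε / 4 * δ ^ 2`; the added ones (here and in `R'`) keep denominators positive.
  set η : ℝ := min 1 (ε / (4 * (2 * ch + cl + 1) * R' ^ 2)) with hηdef
  have hη : 0 < η := lt_min one_pos (by positivity)
  have hη1 : η ≤ 1 := min_le_left _ _
  have hη3 : η ≤ ε / (4 * (2 * ch + cl + 1) * R' ^ 2) := min_le_right _ _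
  have hη2 : (2 * ch + cl) * R ^ 2 * η ≤ ε / 4 := by
    calc (2 * ch + cl) * R ^ 2 * η
        ≤ (2 * ch + cl + 1) * R' ^ 2 * (ε / (4 * (2 * ch + cl + 1) * R' ^ 2)) := by
          gcongr ?_ * ?_ * ?_
          · linarith
          · gcongr
      _ = ε / 4 := by field_simp
  set a : ℝ := ε ^ 2 / (512 * R' ^ 2) with ha
  have ha0 : 0 < a := by positivity
  set L : ℝ := (1 + 2 / η) ^ R * 9 with hL
  have hL1 : 1 ≤ L := by
    have : 1 ≤ (1 + 2 / η) ^ R := one_le_pow₀ (by have : 0 < 2 / η := by positivity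
                                                  linarith)
    linarith
  -- `L ^ n` counts the net together with the operator-norm net at each of its points. This constant
  -- gives `a * δ ^ 2 ≥ (log L + 1) * n`, so the union bound still leaves `exp (-n)`.
  refine ⟨(Real.log L + 1) / a, by have := Real.log_nonneg hL1; positivity, ?_⟩
  intro ι κ _ _ X τ q₀ δ hX hind h0 h1 hreg hδ hC
  set n := Fintype.card ι + Fintype.card κ with hn
  set S : Set (Fin R → EuclideanSpace ℝ ι × EuclideanSpace ℝ κ) :=
    {x | ‖x‖ ≤ 1 ∧ ∀ q, |(δ • lowRank x) q| ≤ B} with hS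
  -- The net consists of points of `S`, so the entrywise bound `B`, needed for the density bounds,
  -- holds at the net points too.
  obtain ⟨s, hs, hcard, hnet⟩ := exists_finset_net hη S (fun x hx => hx.1)
  have hdim : Module.finrank ℝ (Fin R → EuclideanSpace ℝ ι × EuclideanSpace ℝ κ) = R * n := by
    rw [Module.finrank_pi_fintype]
    simp [Module.finrank_prod, hn]
  rw [hdim] at hcard
  -- This makes `m ^ 2 / 2 = a * δ ^ 2` and the noise term of the transfer at most `ε / 4 * δ ^ 2`.
  -- The three errors then total `3/4` of the allowance.
  set m : ℝ := ε * δ / (16 * R') with hm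
  have hm0 : 0 ≤ m := by positivity
  let gbar : (Fin R → EuclideanSpace ℝ ι × EuclideanSpace ℝ κ) → EuclideanSpace ℝ (ι × κ) :=
    fun y => WithLp.toLp 2 fun q => ∫ ω, checkGrad τ (X q ω) (q₀ q + (δ • lowRank y) q) ∂P
  let bad₁ : (Fin R → EuclideanSpace ℝ ι × EuclideanSpace ℝ κ) → Set Ω := fun y =>
    {ω | excessLoss τ q₀ (fun q => X q ω) (δ • lowRank y) <
      cl / 4 * ‖δ • lowRank y‖ ^ 2 - ε / 4 * δ ^ 2}
  let bad₂ : (Fin R → EuclideanSpace ℝ ι × EuclideanSpace ℝ κ) → Set Ω := fun y =>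
    {ω | ¬ BilinBound (lossGrad τ q₀ (fun q => X q ω) (δ • lowRank y) - gbar y) (2 * m)}
  have hexp : ∀ y ∈ s, P.real (bad₁ y ∪ bad₂ y) ≤ 2 * (9 ^ n * Real.exp (-(a * δ ^ 2))) := by
    intro y hy
    obtain ⟨hy1, hyB⟩ := hs y hy
    have hb1 : P.real (bad₁ y) ≤ 9 ^ n * Real.exp (-(a * δ ^ 2)) := by
      have hnorm : ‖δ • lowRank y‖ ^ 2 ≤ R' ^ 2 * δ ^ 2 := by
        rw [norm_smul, Real.norm_of_nonneg hδ.le, mul_pow, mul_comm]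
        gcongr
        exact (norm_lowRank_le hy1).trans hRR'
      refine (measureReal_excessLoss_lt_le hX hind h0 h1 hreg hyB hnorm
        (e := ε / 4 * δ ^ 2) (by positivity)).trans ?_
      have h9 : (1 : ℝ) ≤ 9 ^ n := one_le_pow₀ (by norm_num)
      refine le_trans ?_ (le_mul_of_one_le_left (Real.exp_pos _).le h9)
      rw [Real.exp_le_exp]
      have : -(ε / 4 * δ ^ 2) ^ 2 / (2 * (R' ^ 2 * δ ^ 2)) = -(16 * (a * δ ^ 2)) := by
        rw [ha]; field_simp; norm_num
      rw [this]
      have : 0 ≤ a * δ ^ 2 := by positivity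
      linarith
    have hb2 : P.real (bad₂ y) ≤ 9 ^ n * Real.exp (-(a * δ ^ 2)) := by
      have hind' : iIndepFun (fun q ω => checkGrad τ (X q ω) (q₀ q + (δ • lowRank y) q)
          - ∫ ω, checkGrad τ (X q ω) (q₀ q + (δ • lowRank y) q) ∂P) P :=
        hind.comp (fun q x => checkGrad τ x (q₀ q + (δ • lowRank y) q)
          - ∫ ω, checkGrad τ (X q ω) (q₀ q + (δ • lowRank y) q) ∂P)
          (fun q => (measurable_checkGrad τ _).sub_const _)
      have := measureReal_not_bilinBound_le hind'
        (fun q => hasSubgaussianMGF_checkGrad hX h0 h1 _ q) hm0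
      have e : -m ^ 2 / 2 = -(a * δ ^ 2) := by
        rw [hm, ha]; field_simp; norm_num
      rw [e] at this
      exact this
    refine (measureReal_union_le _ _).trans ?_
    linarith
  have hsub : {ω | ∃ x : Fin R → EuclideanSpace ℝ ι × EuclideanSpace ℝ κ, ‖x‖ ≤ 1 ∧
        (∀ q, |(δ • lowRank x) q| ≤ B) ∧
        excessLoss τ q₀ (fun q => X q ω) (δ • lowRank x) <
          cl / 4 * ‖δ • lowRank x‖ ^ 2 - ε * δ ^ 2} ⊆ ⋃ y ∈ s, (bad₁ y ∪ bad₂ y) := by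
    rintro ω ⟨x, hx1, hxB, hlt⟩
    obtain ⟨y, hy, hxy⟩ := hnet x ⟨hx1, hxB⟩
    by_contra hcon
    simp only [Set.mem_iUnion, Set.mem_union, not_exists, not_or] at hcon
    obtain ⟨hg1, hg2⟩ := hcon y hy
    obtain ⟨hy1, hyB⟩ := hs y hy
    have hg1' : cl / 4 * ‖δ • lowRank y‖ ^ 2 - ε / 4 * δ ^ 2 ≤
        excessLoss τ q₀ (fun q => X q ω) (δ • lowRank y) := not_lt.1 hg1
    have hg2' : BilinBound _ (2 * m) := not_not.1 hg2
    have key := excessLoss_lower_of_near hx1 hy1 hη hxy hδ.le (c := cl / 4) (by positivity) hch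
      (norm_integral_checkGrad_le hX hch hreg hyB) hg2' hg1'
    have t1 : (2 * ch + 4 * (cl / 4)) * R ^ 2 * η * δ ^ 2 ≤ ε / 4 * δ ^ 2 := by
      have : (2 * ch + 4 * (cl / 4)) = 2 * ch + cl := by ring
      rw [this]
      gcongr
    have t2 : 4 * R * η * m * δ ≤ ε / 4 * δ ^ 2 := by
      calc 4 * R * η * m * δ ≤ 4 * R' * 1 * m * δ := by gcongr
        _ = ε / 4 * δ ^ 2 := by rw [hm]; field_simp; norm_num
    have : 0 < ε * δ ^ 2 := by positivity
    linarith
  refine (measureReal_mono hsub (measure_ne_top _ _)).trans ?_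
  refine (measureReal_biUnion_finset_le _ _).trans ?_
  refine (Finset.sum_le_sum hexp).trans ?_
  rw [Finset.sum_const, nsmul_eq_mul]
  have hLn : L ^ n * Real.exp (-(a * δ ^ 2)) ≤ Real.exp (-(n : ℝ)) := by
    have hL0 : 0 < L := by linarith
    have e : L ^ n = Real.exp (n * Real.log L) := by
      rw [Real.exp_nat_mul, Real.exp_log hL0]
    rw [e, ← Real.exp_add, Real.exp_le_exp]
    have : (Real.log L + 1) * n ≤ a * δ ^ 2 := by
      have := mul_le_mul_of_nonneg_left hC ha0.le
      refine le_trans (le_of_eq ?_) this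
      field_simp
    linarith
  calc (s.card : ℝ) * (2 * (9 ^ n * Real.exp (-(a * δ ^ 2))))
      ≤ (1 + 2 / η) ^ (R * n) * (2 * (9 ^ n * Real.exp (-(a * δ ^ 2)))) := by gcongr
    _ = 2 * (L ^ n * Real.exp (-(a * δ ^ 2))) := by rw [hL, mul_pow, ← pow_mul]; ring
    _ ≤ _ := by gcongr

end Probability

/-! ### Bounded factorizations, and extension beyond the ball -/

section LowRank

/-- A subspace of dimension at most `R` has a frame of `R` vectors, orthonormal up to zeros. -/
lemma exists_frame {E : Type*} [NormedAddCommGroup E] [InnerProductSpace ℝ E] {R : ℕ}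
    (W : Submodule ℝ E) [FiniteDimensional ℝ W] (hW : Module.finrank ℝ W ≤ R) :
    ∃ v : Fin R → E, (∀ j, ‖v j‖ ≤ 1) ∧ ∀ w ∈ W, ∑ j, inner ℝ (v j) w • v j = w := by
  let e := stdOrthonormalBasis ℝ W
  have hinj := Fin.castLE_injective hW
  let v : Fin R → E := Function.extend (Fin.castLE hW) (fun k => (e k : E)) 0
  have hv : ∀ k, v (Fin.castLE hW k) = e k := fun k => hinj.extend_apply _ _ k
  have hv0 : ∀ j, j ∉ Set.range (Fin.castLE hW) → v j = 0 := fun j hj => by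
    simpa using Function.extend_apply' (g := fun k => (e k : E)) (e' := (0 : Fin R → E)) j hj
  refine ⟨v, fun j => ?_, fun w hw => ?_⟩
  · by_cases hj : j ∈ Set.range (Fin.castLE hW)
    · obtain ⟨k, rfl⟩ := hj
      rw [hv, ← Submodule.coe_norm, e.orthonormal.1 k]
    · rw [hv0 j hj]
      simp
  · have h1 := e.sum_repr' ⟨w, hw⟩
    have h2 := congrArg (Subtype.val) h1
    simp only [Submodule.coe_inner] at h2
    rw [← Fintype.sum_of_injective (Fin.castLE hW) hinj
      (fun k => inner ℝ ((e k : W) : E) w • ((e k : W) : E)) _ (fun j hj => by simp [hv0 j hj])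
      (fun k => by rw [hv])]
    rw [Submodule.coe_sum] at h2
    simpa using h2

variable {ι κ : Type*} [Fintype ι] [Fintype κ]

/-- The array `d` has rank at most `R`. -/
def RankAtMost (R : ℕ) (d : EuclideanSpace ℝ (ι × κ)) : Prop :=
  ∃ (a : ι → Fin R → ℝ) (b : Fin R → EuclideanSpace ℝ κ), ∀ i t, d (i, t) = ∑ j, a i j * b j t

omit [Fintype ι] [Fintype κ] in
lemma RankAtMost.smul {R : ℕ} {d : EuclideanSpace ℝ (ι × κ)} (h : RankAtMost R d) (s : ℝ) :
    RankAtMost R (s • d) := by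
  obtain ⟨a, b, h⟩ := h
  refine ⟨fun i j => s * a i j, b, fun i t => ?_⟩
  simp [h, Finset.mul_sum, mul_assoc]

/-- Low-rank arrays in a ball have a bounded parametrization. -/
lemma RankAtMost.exists_lowRank {R : ℕ} {d : EuclideanSpace ℝ (ι × κ)} (h : RankAtMost R d)
    {δ : ℝ} (hδ : 0 < δ) (hd : ‖d‖ ≤ δ) :
    ∃ x : Fin R → EuclideanSpace ℝ ι × EuclideanSpace ℝ κ, ‖x‖ ≤ 1 ∧ δ • lowRank x = d := by
  obtain ⟨a, b, hab⟩ := h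
  obtain ⟨v, hv1, hv⟩ := exists_frame (R := R) (Submodule.span ℝ (Set.range b))
    ((finrank_range_le_card b).trans (by simp))
  let row : ι → EuclideanSpace ℝ κ := fun i => WithLp.toLp 2 fun t => d (i, t)
  have hrow : ∀ i, row i ∈ Submodule.span ℝ (Set.range b) := fun i => by
    have : row i = ∑ j, a i j • b j := by
      ext t
      simp [row, hab]
    rw [this]
    exact Submodule.sum_mem _ fun j _ => Submodule.smul_mem _ _ (Submodule.subset_span ⟨j, rfl⟩)
  -- The given factors may be arbitrarily large. Expanding the rows in a frame of the row space
  -- bounds each coefficient vector by `‖d‖ / δ ≤ 1`.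
  let u : Fin R → EuclideanSpace ℝ ι := fun j => WithLp.toLp 2 fun i => δ⁻¹ * inner ℝ (v j) (row i)
  refine ⟨fun j => (u j, v j), ?_, ?_⟩
  · rw [pi_norm_le_iff_of_nonneg zero_le_one]
    intro j
    refine max_le ?_ (hv1 j)
    show ‖u j‖ ≤ 1
    rw [← sq_le_one_iff₀ (norm_nonneg _), EuclideanSpace.real_norm_sq_eq]
    calc ∑ i, (u j i) ^ 2 ≤ ∑ i, δ⁻¹ ^ 2 * ‖row i‖ ^ 2 := by
          refine Finset.sum_le_sum fun i _ => ?_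
          show (δ⁻¹ * inner ℝ (v j) (row i)) ^ 2 ≤ _
          rw [mul_pow]
          refine mul_le_mul_of_nonneg_left ?_ (sq_nonneg _)
          rw [sq_le_sq, abs_norm]
          exact (abs_real_inner_le_norm _ _).trans
            (mul_le_of_le_one_left (norm_nonneg _) (hv1 j))
      _ = δ⁻¹ ^ 2 * ‖d‖ ^ 2 := by
          rw [← Finset.mul_sum, EuclideanSpace.real_norm_sq_eq d, Fintype.sum_prod_type]
          simp only [EuclideanSpace.real_norm_sq_eq, row]
      _ ≤ δ⁻¹ ^ 2 * δ ^ 2 := by gcongr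
      _ = 1 := by field_simp
  · ext ⟨i, t⟩
    have h1 := congrArg (fun z : EuclideanSpace ℝ κ => z t) (hv (row i) (hrow i))
    have h2 : (row i) t = d (i, t) := rfl
    rw [← h2, ← h1]
    simp only [lowRank, PiLp.smul_apply, WithLp.ofLp_sum, Finset.sum_apply, rankOne_apply,
      smul_eq_mul, Finset.mul_sum]
    refine Finset.sum_congr rfl fun j _ => ?_
    show δ * (δ⁻¹ * inner ℝ (v j) (row i) * v j t) = _
    field_simp

/-- By convexity, a lower bound in the ball of radius `δ` extends to shifts of any size. -/
lemma excessLoss_lower_of_ball {R : ℕ} {B c ε δ τ : ℝ} {q₀ w : ι × κ → ℝ} (hδ : 0 < δ)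
    (hc : 0 ≤ c) (hε : 0 ≤ ε) (hεc : ε ≤ c)
    (hball : ∀ x : Fin R → EuclideanSpace ℝ ι × EuclideanSpace ℝ κ, ‖x‖ ≤ 1 →
      (∀ q, |(δ • lowRank x) q| ≤ B) →
      c * ‖δ • lowRank x‖ ^ 2 - ε * δ ^ 2 ≤ excessLoss τ q₀ w (δ • lowRank x))
    {d : EuclideanSpace ℝ (ι × κ)} (hd : RankAtMost R d) (hB : ∀ q, |d q| ≤ B) :
    -(ε * δ ^ 2) ≤ excessLoss τ q₀ w d ∧
      (δ ^ 2 ≤ ‖d‖ ^ 2 → (c - ε) * δ ^ 2 ≤ excessLoss τ q₀ w d) := by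
  have hin : ∀ d : EuclideanSpace ℝ (ι × κ), RankAtMost R d → (∀ q, |d q| ≤ B) → ‖d‖ ≤ δ →
      c * ‖d‖ ^ 2 - ε * δ ^ 2 ≤ excessLoss τ q₀ w d := by
    intro d hd hB hn
    obtain ⟨x, hx, rfl⟩ := hd.exists_lowRank hδ hn
    exact hball x hx hB
  have hcε : 0 ≤ (c - ε) * δ ^ 2 := mul_nonneg (sub_nonneg.2 hεc) (sq_nonneg δ)
  have hout : δ ≤ ‖d‖ → (c - ε) * δ ^ 2 ≤ excessLoss τ q₀ w d := by
    intro hn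
    have hpos : 0 < ‖d‖ := hδ.trans_le hn
    -- Shrink `d` to the sphere of radius `δ`, which preserves the rank and the entrywise bound. The
    -- ray inequality carries the bound back out, as dividing by `s ≤ 1` only enlarges a nonnegative
    -- number.
    set s := δ / ‖d‖ with hs
    have hs0 : 0 < s := by positivity
    have hs1 : s ≤ 1 := (div_le_one hpos).2 hn
    have hnorm : ‖s • d‖ = δ := by
      rw [norm_smul, Real.norm_of_nonneg hs0.le, hs]
      field_simp
    have h1 := hin (s • d) (hd.smul s) (fun q => by
      have : (s • d) q = s * d q := rfl
      rw [this, abs_mul, abs_of_pos hs0]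
      exact (mul_le_of_le_one_left (abs_nonneg _) hs1).trans (hB q)) hnorm.le
    rw [hnorm] at h1
    have h2 := excessLoss_ray τ q₀ w d hs0.le hs1
    by_contra! hcon
    have h3 : (c - ε) * δ ^ 2 ≤ s * excessLoss τ q₀ w d := by linarith
    have h4 : s * excessLoss τ q₀ w d < s * ((c - ε) * δ ^ 2) := by gcongr
    have h5 : s * ((c - ε) * δ ^ 2) ≤ (c - ε) * δ ^ 2 := mul_le_of_le_one_left hcε hs1
    linarith
  refine ⟨?_, fun h => hout ((sq_le_sq₀ hδ.le (norm_nonneg _)).1 h)⟩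
  rcases le_total ‖d‖ δ with hn | hn
  · have := hin d hd hB hn
    have h2 : 0 ≤ c * ‖d‖ ^ 2 := by positivity
    linarith
  · have h2 : 0 ≤ ε * δ ^ 2 := by positivity
    linarith [hout hn]

end LowRank

/-! ### Approximation error with too few factors -/

section RankDeficient

lemma mulVec_dotProduct_mulVec_self {m n : Type*} [Fintype m] [Fintype n] (A : Matrix m n ℝ)
    (x : n → ℝ) : (A *ᵥ x) ⬝ᵥ (A *ᵥ x) = x ⬝ᵥ ((Aᵀ * A) *ᵥ x) := by
  rw [← Matrix.mulVec_mulVec, Matrix.dotProduct_mulVec x Aᵀ, Matrix.vecMul_transpose]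

/-- A factor structure with fewer factors than the true one misses a positive proportion of the
common component. -/
lemma le_sum_sq_sub_of_lt {N T ℓ r : ℕ} (hℓ : ℓ < r) (L : Matrix (Fin N) (Fin ℓ) ℝ)
    (F : Matrix (Fin T) (Fin ℓ) ℝ) (L₀ : Matrix (Fin N) (Fin r) ℝ) (F₀ : Matrix (Fin T) (Fin r) ℝ)
    (hN : 0 < N) (hT : 0 < T) (hF : (T : ℝ)⁻¹ • (F₀ᵀ * F₀) = 1)
    (hL : ((N : ℝ)⁻¹ • (L₀ᵀ * L₀)).IsDiag) {c : ℝ}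
    (hc : ∀ j, c ≤ ((N : ℝ)⁻¹ • (L₀ᵀ * L₀)) j j) :
    c * (N * T) ≤ ∑ i, ∑ t, (L i ⬝ᵥ F t - L₀ i ⬝ᵥ F₀ t) ^ 2 := by
  have hN' : (0 : ℝ) < N := by exact_mod_cast hN
  have hT' : (0 : ℝ) < T := by exact_mod_cast hT
  -- As `ℓ < r`, some true factor direction `y = F₀ x` is orthogonal to all columns of `F`. The
  -- fitted part annihilates `y`, so `D y = -T L₀ x`, which is large; Cauchy–Schwarz in each row
  -- turns this into a bound on the entries of `D`.
  obtain ⟨x, hx, hx0⟩ := (Submodule.ne_bot_iff _).1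
    (LinearMap.ker_ne_bot_of_finrank_lt (f := Matrix.mulVecLin (Fᵀ * F₀)) (by simpa using hℓ))
  have hker : (Fᵀ * F₀) *ᵥ x = 0 := hx
  have hFF : F₀ᵀ * F₀ = (T : ℝ) • (1 : Matrix (Fin r) (Fin r) ℝ) := by
    rw [← hF, smul_smul, mul_inv_cancel₀ hT'.ne', one_smul]
  set G := (N : ℝ)⁻¹ • (L₀ᵀ * L₀) with hG
  have hLL : L₀ᵀ * L₀ = (N : ℝ) • G := by
    rw [hG, smul_smul, mul_inv_cancel₀ hN'.ne', one_smul]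
  set y := F₀ *ᵥ x with hy
  have hxx : 0 < x ⬝ᵥ x := by
    have h0 : 0 ≤ x ⬝ᵥ x := Finset.sum_nonneg fun j _ => mul_self_nonneg (x j)
    exact h0.lt_of_ne fun h => hx0 (dotProduct_self_eq_zero.1 h.symm)
  have hyy : y ⬝ᵥ y = T * (x ⬝ᵥ x) := by
    rw [hy, mulVec_dotProduct_mulVec_self, hFF, Matrix.smul_mulVec, Matrix.one_mulVec,
      dotProduct_smul, smul_eq_mul]
  set D : Matrix (Fin N) (Fin T) ℝ := L * Fᵀ - L₀ * F₀ᵀ with hD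
  have hDe : ∀ i t, D i t = L i ⬝ᵥ F t - L₀ i ⬝ᵥ F₀ t := fun i t => rfl
  have hDy : D *ᵥ y = (-(T : ℝ)) • (L₀ *ᵥ x) := by
    rw [hD, Matrix.sub_mulVec, hy, ← Matrix.mulVec_mulVec, ← Matrix.mulVec_mulVec,
      Matrix.mulVec_mulVec x Fᵀ F₀, hker, Matrix.mulVec_mulVec x F₀ᵀ F₀, hFF, Matrix.mulVec_zero,
      Matrix.smul_mulVec, Matrix.one_mulVec, Matrix.mulVec_smul, zero_sub, neg_smul]
  have hLx : c * N * (x ⬝ᵥ x) ≤ (L₀ *ᵥ x) ⬝ᵥ (L₀ *ᵥ x) := by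
    have hGx : G *ᵥ x = fun j => G j j * x j := by
      ext j
      rw [Matrix.mulVec, dotProduct]
      exact Finset.sum_eq_single j (fun k _ hk => by rw [hL hk.symm, zero_mul]) (by simp)
    have e : (L₀ *ᵥ x) ⬝ᵥ (L₀ *ᵥ x) = N * ∑ j, G j j * (x j * x j) := by
      rw [mulVec_dotProduct_mulVec_self, hLL, Matrix.smul_mulVec, hGx, dotProduct_smul,
        smul_eq_mul]
      congr 1
      exact Finset.sum_congr rfl fun j _ => by ring
    rw [e, dotProduct, Finset.mul_sum, Finset.mul_sum]
    refine Finset.sum_le_sum fun j _ => ?_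
    have := mul_le_mul_of_nonneg_right (hc j) (mul_self_nonneg (x j))
    nlinarith
  have hCS : (D *ᵥ y) ⬝ᵥ (D *ᵥ y) ≤ (∑ i, ∑ t, D i t ^ 2) * (y ⬝ᵥ y) := by
    rw [Finset.sum_mul]
    refine Finset.sum_le_sum fun i _ => ?_
    have := Finset.sum_mul_sq_le_sq_mul_sq Finset.univ (D i) y
    calc (D *ᵥ y) i * (D *ᵥ y) i = (∑ t, D i t * y t) ^ 2 := (sq _).symm
      _ ≤ _ := this
      _ = _ := by
        congr 1
        exact Finset.sum_congr rfl fun t _ => sq _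
  rw [hDy, hyy, smul_dotProduct, dotProduct_smul, smul_eq_mul, smul_eq_mul] at hCS
  simp only [← hDe]
  have h1 : T * T * (c * N * (x ⬝ᵥ x)) ≤ (∑ i, ∑ t, D i t ^ 2) * (T * (x ⬝ᵥ x)) := by
    have := mul_le_mul_of_nonneg_left hLx (mul_pos hT' hT').le
    linarith
  have h2 : c * (N * T) * (T * (x ⬝ᵥ x)) ≤ (∑ i, ∑ t, D i t ^ 2) * (T * (x ⬝ᵥ x)) := by
    linarith
  exact le_of_mul_le_mul_right h2 (mul_pos hT' hxx)

end RankDeficient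

/-! ### The excess-loss bounds in the factor model -/

section Model

variable {K N T ℓ r : ℕ}

/-- The difference of the common components of two factor structures. -/
noncomputable def commonShift (θ : FactorParam K N T ℓ) (θ₀ : FactorParam K N T r) (k : Fin K) :
    EuclideanSpace ℝ (Fin N × Fin T) :=
  WithLp.toLp 2 fun q => θ.common k q.1 q.2 - θ₀.common k q.1 q.2

lemma rankAtMost_commonShift (θ : FactorParam K N T ℓ) (θ₀ : FactorParam K N T r) (k : Fin K) :
    RankAtMost (ℓ + r) (commonShift θ θ₀ k) := by
  refine ⟨fun i => Fin.append (θ.loading k i) (fun j => -θ₀.loading k i j),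
    fun j => WithLp.toLp 2 fun t => (Fin.append (θ.factor t) (θ₀.factor t) : Fin (ℓ + r) → ℝ) j,
    fun i t => ?_⟩
  simp [commonShift, FactorParam.common, dotProduct, Fin.sum_univ_add, sub_eq_add_neg]

lemma objective_sub_objective (τ w : Fin K → ℝ) (x : Fin N → Fin T → ℝ)
    (θ : FactorParam K N T ℓ) (θ₀ : FactorParam K N T r) :
    objective τ w x θ - objective τ w x θ₀ = ((N : ℝ) * T)⁻¹ * ∑ k, w k *
      excessLoss (τ k) (fun q => θ₀.common k q.1 q.2) (fun q => x q.1 q.2)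
        (commonShift θ θ₀ k) := by
  unfold objective
  rw [← mul_sub, ← Finset.sum_sub_distrib]
  congr 1
  refine Finset.sum_congr rfl fun k _ => ?_
  simp only [excessLoss, commonShift, add_sub_cancel, Fintype.sum_prod_type, Finset.mul_sum,
    ← Finset.sum_sub_distrib, mul_sub]

/-- The common components are bounded over the parameter spaces. -/
lemma exists_abs_common_le (kstar : Fin K) {A F : Set (Fin ℓ → ℝ)} (hA : IsCompact A)
    (hF : IsCompact F) :
    ∃ B : ℝ, 0 ≤ B ∧ ∀ N T, ∀ θ ∈ paramSpace kstar A F N T, ∀ k i t, |θ.common k i t| ≤ B := by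
  have hcont : Continuous fun p : (Fin ℓ → ℝ) × (Fin ℓ → ℝ) => p.1 ⬝ᵥ p.2 := by fun_prop
  obtain ⟨B, hB⟩ := ((hA.prod hF).image hcont).isBounded.exists_norm_le
  refine ⟨max B 0, le_max_right _ _, fun N T θ hθ k i t => le_max_of_le_left ?_⟩
  exact hB _ ⟨(θ.loading k i, θ.factor t), ⟨hθ.1 k i, hθ.2.1 t⟩, rfl⟩

/-- This turns `a L² → ∞` into the requirement that `a N T` dominate the order `N + T` of the number
of parameters. -/
lemma rateL_sq_le (N T : ℕ) : rateL N T ^ 2 * (N + T) ≤ 2 * (N * T) := by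
  have h0 : 0 ≤ rateL N T := le_min (Real.sqrt_nonneg _) (Real.sqrt_nonneg _)
  have h1 : rateL N T ^ 2 ≤ (N : ℝ) := by
    calc rateL N T ^ 2 ≤ Real.sqrt N ^ 2 := by gcongr; exact min_le_left _ _
      _ = (N : ℝ) := Real.sq_sqrt (Nat.cast_nonneg N)
  have h2 : rateL N T ^ 2 ≤ (T : ℝ) := by
    calc rateL N T ^ 2 ≤ Real.sqrt T ^ 2 := by gcongr; exact min_le_right _ _
      _ = (T : ℝ) := Real.sq_sqrt (Nat.cast_nonneg T)
  nlinarith [Nat.cast_nonneg (α := ℝ) N, Nat.cast_nonneg (α := ℝ) T]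

lemma tendsto_fst_add_snd_atTop :
    Tendsto (fun p : ℕ × ℕ => ((p.1 + p.2 : ℕ) : ℝ)) atTop atTop := by
  refine tendsto_natCast_atTop_atTop.comp (tendsto_atTop_mono (fun p => Nat.le_add_right p.1 p.2) ?_)
  rw [← prod_atTop_atTop_eq]
  exact tendsto_fst

lemma eventually_pos_pos : ∀ᶠ p : ℕ × ℕ in atTop, 0 < p.1 ∧ 0 < p.2 := by
  filter_upwards [eventually_ge_atTop ((1, 1) : ℕ × ℕ)] with p hp
  exact ⟨hp.1, hp.2⟩

lemma tendsto_rateL_sq_atTop : Tendsto (fun p : ℕ × ℕ => rateL p.1 p.2 ^ 2) atTop atTop := by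
  have h : Tendsto (fun p : ℕ × ℕ => rateL p.1 p.2) atTop atTop := by
    rw [← prod_atTop_atTop_eq]
    refine tendsto_atTop.2 fun b => ?_
    filter_upwards [(Real.tendsto_sqrt_atTop.comp (tendsto_natCast_atTop_atTop.comp
        tendsto_fst)).eventually_ge_atTop b, (Real.tendsto_sqrt_atTop.comp
        (tendsto_natCast_atTop_atTop.comp tendsto_snd)).eventually_ge_atTop b] with p h1 h2
    exact le_min h1 h2
  exact (tendsto_pow_atTop two_ne_zero).comp h

/-- Lower bounds for the excess loss of all parameters, at the scale `a`. -/
def ExcessLossBounded {K N T ℓ r : ℕ} (τ : Fin K → ℝ) (Θ : Set (FactorParam K N T ℓ))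
    (θ₀ : FactorParam K N T r) (x : Fin N → Fin T → ℝ) (c ε a : ℝ) : Prop :=
  ∀ θ ∈ Θ, ∀ k,
    -(ε * (a * (N * T))) ≤ excessLoss (τ k) (fun q => θ₀.common k q.1 q.2)
      (fun q => x q.1 q.2) (commonShift θ θ₀ k) ∧
    (a * (N * T) ≤ ‖commonShift θ θ₀ k‖ ^ 2 →
      (c - ε) * (a * (N * T)) ≤ excessLoss (τ k) (fun q => θ₀.common k q.1 q.2)
        (fun q => x q.1 q.2) (commonShift θ θ₀ k))

/-- The constant `c` is fixed before `ε` and the scale `a`, so both can be adapted to underfitting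
or to overfitting. -/
theorem exists_tendsto_not_excessLossBounded {Ω : Type*} [MeasurableSpace Ω] {P : Measure Ω}
    [IsProbabilityMeasure P] {K r s : ℕ} {τ : Fin K → ℝ} (hτ01 : ∀ k, 0 < τ k ∧ τ k < 1)
    {kstar : Fin K} {A F : (ℓ : ℕ) → Set (Fin ℓ → ℝ)}
    {X : (N T : ℕ) → Fin N → Fin T → Ω → ℝ} {h : (N T : ℕ) → Fin N → Fin T → ℝ → ℝ}
    {θ₀ : (N T : ℕ) → FactorParam K N T r} (hmodel : FactorModel P τ X h θ₀)
    (hcons : ConsistencyAssumption P kstar A F X h θ₀)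
    (hnum : FactorNumberAssumption s A F h θ₀) (ℓ : ℕ) :
    ∃ c > 0, ∀ ε, 0 < ε → ε ≤ c → ∀ a : ℕ × ℕ → ℝ,
      Tendsto (fun p => a p * rateL p.1 p.2 ^ 2) atTop atTop →
      Tendsto (fun p : ℕ × ℕ => P.real {ω | ¬ ExcessLossBounded τ
        (paramSpace kstar (A ℓ) (F ℓ) p.1 p.2) (θ₀ p.1 p.2) (fun i t => X p.1 p.2 i t ω) c ε (a p)})
        atTop (𝓝 0) := by
  obtain ⟨B₁, hB₁, hB₁b⟩ := exists_abs_common_le (ℓ := ℓ) kstar (hcons.compact ℓ).1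
    (hcons.compact ℓ).2
  obtain ⟨B₀, hB₀, hB₀b⟩ := exists_abs_common_le (ℓ := r) kstar (hcons.compact r).1
    (hcons.compact r).2
  set B := B₁ + B₀ with hB
  -- True quantiles are at most `B₀` and shifts at most `B` in absolute value, so this interval
  -- contains every segment on which a density is used.
  obtain ⟨cl, hcl, hlo⟩ := hcons.density_lower (Set.Icc (-(B₀ + B)) (B₀ + B)) isCompact_Icc
  obtain ⟨ch, hch, hhi⟩ := hnum.density_upper (Set.Icc (-(B₀ + B)) (B₀ + B)) isCompact_Icc
  refine ⟨cl / 4, by positivity, fun ε hε hεc a ha => ?_⟩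
  obtain ⟨C, hC, hmain⟩ := exists_measureReal_excessLoss_lt_le (P := P) (ℓ + r) B hcl.le hch.le hε
  have hlim : Tendsto (fun p : ℕ × ℕ => (K : ℝ) * (2 * Real.exp (-((p.1 + p.2 : ℕ) : ℝ))))
      atTop (𝓝 0) := by
    have := ((Real.tendsto_exp_neg_atTop_nhds_zero.comp tendsto_fst_add_snd_atTop).const_mul
      2).const_mul (K : ℝ)
    simpa using this
  refine squeeze_zero' (Eventually.of_forall fun p => measureReal_nonneg) ?_ hlim
  filter_upwards [hlo, hhi, hmodel.quantile_eq, hmodel.density, hcons.true_mem, hcons.indep,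
    eventually_pos_pos, ha.eventually_ge_atTop (2 * C)] with p hlo hhi hq hdens htrue hind hpos hap
  obtain ⟨N, T⟩ := p
  simp only at *
  have hNT : (0 : ℝ) < N * T := by
    have h1 : (0 : ℝ) < N := by exact_mod_cast hpos.1
    have h2 : (0 : ℝ) < T := by exact_mod_cast hpos.2
    positivity
  have ha0 : 0 < a (N, T) := by
    by_contra! hcon
    nlinarith [sq_nonneg (rateL N T)]
  -- After division by `N T`, a squared radius `δ²` becomes the scale `a` of the objective.
  set δ := Real.sqrt (a (N, T) * (N * T)) with hδdef
  have hδ : 0 < δ := Real.sqrt_pos.2 (by positivity)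
  have hδ2 : δ ^ 2 = a (N, T) * (N * T) := Real.sq_sqrt (by positivity)
  have hsize : C * (Fintype.card (Fin N) + Fintype.card (Fin T) : ℕ) ≤ δ ^ 2 := by
    rw [hδ2, Fintype.card_fin, Fintype.card_fin]
    push_cast
    have h1 := mul_le_mul_of_nonneg_left (rateL_sq_le N T) ha0.le
    have h2 := mul_le_mul_of_nonneg_right hap
      (add_nonneg (Nat.cast_nonneg (α := ℝ) N) (Nat.cast_nonneg (α := ℝ) T))
    nlinarith
  let bad : Fin K → Set Ω := fun k =>
    {ω | ∃ x : Fin (ℓ + r) → EuclideanSpace ℝ (Fin N) × EuclideanSpace ℝ (Fin T), ‖x‖ ≤ 1 ∧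
        (∀ q, |(δ • lowRank x) q| ≤ B) ∧
        excessLoss (τ k) (fun q => (θ₀ N T).common k q.1 q.2) (fun q => X N T q.1 q.2 ω)
          (δ • lowRank x) < cl / 4 * ‖δ • lowRank x‖ ^ 2 - ε * δ ^ 2}
  have hbad : ∀ k ∈ Finset.univ, P.real (bad k) ≤ 2 * Real.exp (-((N + T : ℕ) : ℝ)) := by
    intro k _
    have hindX : iIndepFun (fun (q : Fin N × Fin T) (ω : Ω) => X N T q.1 q.2 ω) P := by
      have := (hind k).comp (fun q x => x + (θ₀ N T).common k q.1 q.2)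
        (fun q => measurable_id.add_const _)
      convert! this using 3
      simp
    have hreg : ∀ q : Fin N × Fin T, RegularQuantile (P.map fun ω => X N T q.1 q.2 ω) (τ k)
        ((θ₀ N T).common k q.1 q.2) B cl ch := by
      intro q
      have : IsProbabilityMeasure (P.map fun ω => X N T q.1 q.2 ω) :=
        Measure.isProbabilityMeasure_map (hmodel.measurable N T q.1 q.2).aemeasurable
      exact regularQuantile_of_density (hdens q.1 q.2) (hτ01 k).1 (hτ01 k).2 (hq k q.1 q.2)
        (hB₀b N T _ htrue k q.1 q.2) hcl.le (hlo q.1 q.2) (hhi q.1 q.2)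
    have := hmain (fun q : Fin N × Fin T => hmodel.measurable N T q.1 q.2) hindX (hτ01 k).1.le
      (hτ01 k).2.le hreg hδ hsize
    rwa [Fintype.card_fin, Fintype.card_fin] at this
  have hsub : {ω | ¬ ExcessLossBounded τ (paramSpace kstar (A ℓ) (F ℓ) N T) (θ₀ N T)
      (fun i t => X N T i t ω) (cl / 4) ε (a (N, T))} ⊆ ⋃ k ∈ Finset.univ, bad k := by
    intro ω hω
    by_contra hcon
    simp only [Set.mem_iUnion, not_exists] at hcon
    refine hω fun θ hθ k => ?_
    have hball := hcon k (Finset.mem_univ k)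
    rw [← hδ2]
    refine excessLoss_lower_of_ball (B := B) hδ (by positivity) hε.le hεc ?_
      (rankAtMost_commonShift θ (θ₀ N T) k) fun q => ?_
    · intro x hx hxB
      by_contra! hlt
      exact hball ⟨x, hx, hxB, hlt⟩
    · exact (abs_sub _ _).trans (add_le_add (hB₁b N T θ hθ k q.1 q.2)
        (hB₀b N T _ htrue k q.1 q.2))
  refine (measureReal_mono hsub (measure_ne_top _ _)).trans ?_
  refine (measureReal_biUnion_finset_le _ _).trans ?_
  refine (Finset.sum_le_sum hbad).trans (le_of_eq ?_)
  simp

end Model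

/-! ### Comparison of the penalized criteria -/

section Selection

variable {K N T ℓ r : ℕ}

lemma ExcessLossBounded.objective_ge {τ w : Fin K → ℝ} (hw : ∀ k, 0 < w k)
    {Θ : Set (FactorParam K N T ℓ)} {θ₀ : FactorParam K N T r} {x : Fin N → Fin T → ℝ}
    {c ε a : ℝ} (h : ExcessLossBounded τ Θ θ₀ x c ε a) (hN : 0 < N) (hT : 0 < T)
    {θ : FactorParam K N T ℓ} (hθ : θ ∈ Θ) :
    -((∑ k, w k) * ε * a) ≤ objective τ w x θ - objective τ w x θ₀ := by
  have hNT : (0 : ℝ) < N * T := by positivity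
  rw [objective_sub_objective, inv_mul_eq_div, le_div_iff₀ hNT]
  calc -((∑ k, w k) * ε * a) * (N * T) = ∑ k, w k * -(ε * (a * (N * T))) := by
        rw [← Finset.sum_mul]; ring
    _ ≤ _ := Finset.sum_le_sum fun k _ => mul_le_mul_of_nonneg_left (h θ hθ k).1 (hw k).le

/-- One distant quantile level is enough: it contributes its gain, and every level loses at most its
share of `ε`. -/
lemma ExcessLossBounded.objective_ge_of_far {τ w : Fin K → ℝ} (hw : ∀ k, 0 < w k)
    {Θ : Set (FactorParam K N T ℓ)} {θ₀ : FactorParam K N T r} {x : Fin N → Fin T → ℝ}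
    {c ε a : ℝ} (h : ExcessLossBounded τ Θ θ₀ x c ε a) (hN : 0 < N) (hT : 0 < T)
    {θ : FactorParam K N T ℓ} (hθ : θ ∈ Θ) {k₀ : Fin K}
    (hfar : a * (N * T) ≤ ‖commonShift θ θ₀ k₀‖ ^ 2) :
    (w k₀ * c - (∑ k, w k) * ε) * a ≤ objective τ w x θ - objective τ w x θ₀ := by
  have hNT : (0 : ℝ) < N * T := by positivity
  rw [objective_sub_objective, inv_mul_eq_div, le_div_iff₀ hNT]
  calc (w k₀ * c - (∑ k, w k) * ε) * a * (N * T)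
      = ∑ k, (w k * -(ε * (a * (N * T))) + if k = k₀ then w k₀ * (c * (a * (N * T))) else 0) := by
        rw [Finset.sum_add_distrib, ← Finset.sum_mul, Finset.sum_ite_eq' Finset.univ k₀]
        simp
        ring
    _ ≤ _ := Finset.sum_le_sum fun k _ => ?_
  split_ifs with hk
  · subst hk
    have := mul_le_mul_of_nonneg_left ((h θ hθ k).2 hfar) (hw k).le
    linarith
  · have := mul_le_mul_of_nonneg_left (h θ hθ k).1 (hw k).le
    linarith

/-- With too few factors, the common component of the truth is missed. -/
lemma le_norm_sq_commonShift {kstar : Fin K} {A F : Set (Fin r → ℝ)} (hℓ : ℓ < r)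
    (θ : FactorParam K N T ℓ) {θ₀ : FactorParam K N T r} (hθ₀ : θ₀ ∈ paramSpace kstar A F N T)
    (hN : 0 < N) (hT : 0 < T) {c : ℝ} (hc : ∀ j, c ≤ θ₀.loadingGram kstar j j) :
    c * (N * T) ≤ ‖commonShift θ θ₀ kstar‖ ^ 2 := by
  rw [EuclideanSpace.real_norm_sq_eq, Fintype.sum_prod_type]
  exact le_sum_sq_sub_of_lt hℓ (θ.loading kstar) θ.factor (θ₀.loading kstar) θ₀.factor hN hT
    hθ₀.2.2.1 hθ₀.2.2.2.1 hc

end Selection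

/-- The same bound is used at two scales: a constant below all the limits `ν j` when `ℓ < r`, and
the penalty itself when `ℓ > r`. -/
theorem tendsto_measureReal_not_lt_criterion {Ω : Type*} [MeasurableSpace Ω] {P : Measure Ω}
    [IsProbabilityMeasure P] {K r s : ℕ} (hr : 1 ≤ r)
    {τ w : Fin K → ℝ} (hτ01 : ∀ k, 0 < τ k ∧ τ k < 1) (hw : ∀ k, 0 < w k)
    {kstar : Fin K} {A F : (ℓ : ℕ) → Set (Fin ℓ → ℝ)}
    {X : (N T : ℕ) → Fin N → Fin T → Ω → ℝ} {h : (N T : ℕ) → Fin N → Fin T → ℝ → ℝ}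
    {θ₀ : (N T : ℕ) → FactorParam K N T r} (hmodel : FactorModel P τ X h θ₀)
    (hcons : ConsistencyAssumption P kstar A F X h θ₀)
    (hnum : FactorNumberAssumption s A F h θ₀)
    {pen : ℕ → ℕ → ℝ}
    (hpen0 : Tendsto (fun p : ℕ × ℕ => pen p.1 p.2) atTop (𝓝 0))
    (hpenL : Tendsto (fun p : ℕ × ℕ => pen p.1 p.2 * rateL p.1 p.2 ^ 2) atTop atTop)
    {ℓ : ℕ} (hℓr : ℓ ≠ r) :
    Tendsto (fun p : ℕ × ℕ => P.real {ω | ¬ ∀ θ ∈ paramSpace kstar (A ℓ) (F ℓ) p.1 p.2,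
      objective τ w (fun i t => X p.1 p.2 i t ω) (θ₀ p.1 p.2) + r * pen p.1 p.2 <
        objective τ w (fun i t => X p.1 p.2 i t ω) θ + ℓ * pen p.1 p.2}) atTop (𝓝 0) := by
  obtain ⟨c, hc, hbound⟩ := exists_tendsto_not_excessLossBounded hτ01 hmodel hcons hnum ℓ
  set W := ∑ k, w k with hW
  have hWpos : 0 < W := Finset.sum_pos (fun k _ => hw k) ⟨kstar, Finset.mem_univ _⟩
  have hpenpos : ∀ᶠ p : ℕ × ℕ in atTop, 0 < pen p.1 p.2 := by
    filter_upwards [hpenL.eventually_gt_atTop 0] with p hp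
    exact pos_of_mul_pos_left hp (sq_nonneg _)
  rcases lt_or_gt_of_ne hℓr with hlt | hgt
  · obtain ⟨ν, -, hν0, hν⟩ := hcons.eigen_limit
    have : Nonempty (Fin r) := ⟨⟨0, hr⟩⟩
    obtain ⟨j₀, hj₀⟩ := Finite.exists_min ν
    set b := ν j₀ / 2 with hb
    have hb0 : 0 < b := by have := hν0 j₀; positivity
    have hgram : ∀ᶠ p : ℕ × ℕ in atTop, ∀ j, b ≤ (θ₀ p.1 p.2).loadingGram kstar j j := by
      refine eventually_all.2 fun j => ?_
      have : b < ν j := by have := hν0 j₀; have := hj₀ j; rw [hb]; linarith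
      filter_upwards [(hν j).eventually (lt_mem_nhds this)] with p hp using hp.le
    -- The losses over all levels eat at most half of the gain at `kstar`, leaving a fixed positive
    -- gap that `r * pen` cannot close.
    set ε := min c (w kstar * c / (2 * W)) with hε
    have hε0 : 0 < ε := lt_min hc (div_pos (mul_pos (hw kstar) hc) (by positivity))
    have hεW : W * ε ≤ w kstar * c / 2 := by
      calc W * ε ≤ W * (w kstar * c / (2 * W)) := by gcongr; exact min_le_right _ _
        _ = _ := by field_simp
    have hgap : 0 < w kstar * c / 2 * b := by have := hw kstar; positivity
    have hsmall : ∀ᶠ p : ℕ × ℕ in atTop, r * pen p.1 p.2 < w kstar * c / 2 * b := by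
      have := hpen0.const_mul (r : ℝ)
      rw [mul_zero] at this
      exact this.eventually (gt_mem_nhds hgap)
    refine squeeze_zero' (Eventually.of_forall fun p => measureReal_nonneg) ?_
      (hbound ε hε0 (min_le_left _ _) (fun _ => b) (tendsto_rateL_sq_atTop.const_mul_atTop hb0))
    filter_upwards [hgram, hsmall, hpenpos, eventually_pos_pos, hcons.true_mem]
      with p hgram hsmall hpenpos hpos htrue
    refine measureReal_mono (fun ω hω hgood => hω fun θ hθ => ?_) (measure_ne_top _ _)
    have h1 := hgood.objective_ge_of_far hw hpos.1 hpos.2 hθ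
      (le_norm_sq_commonShift hlt θ htrue hpos.1 hpos.2 hgram)
    have h2 : w kstar * c / 2 * b ≤ (w kstar * c - W * ε) * b := by
      gcongr
      linarith
    have h3 : 0 ≤ (ℓ : ℝ) * pen p.1 p.2 := by positivity
    linarith
  -- Overfitting can lower the objective by at most `pen / 2`, while at least one extra factor costs
  -- `pen`.
  · set ε := min c (1 / (2 * W)) with hε
    have hε0 : 0 < ε := lt_min hc (by positivity)
    have hεW : W * ε ≤ 1 / 2 := by
      calc W * ε ≤ W * (1 / (2 * W)) := by gcongr; exact min_le_right _ _
        _ = _ := by field_simp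
    refine squeeze_zero' (Eventually.of_forall fun p => measureReal_nonneg) ?_
      (hbound ε hε0 (min_le_left _ _) (fun p => pen p.1 p.2) hpenL)
    filter_upwards [hpenpos, eventually_pos_pos] with p hpenpos hpos
    refine measureReal_mono (fun ω hω hgood => hω fun θ hθ => ?_) (measure_ne_top _ _)
    have h1 := hgood.objective_ge hw hpos.1 hpos.2 hθ
    have h2 : W * ε * pen p.1 p.2 ≤ 1 / 2 * pen p.1 p.2 := by gcongr
    have h3 : ((r : ℝ) + 1) * pen p.1 p.2 ≤ ℓ * pen p.1 p.2 := by
      gcongr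
      exact_mod_cast hgt
    linarith

theorem theorem3 {Ω : Type*} [MeasurableSpace Ω] (P : Measure Ω) [IsProbabilityMeasure P]
    (K r s : ℕ) (hr : 1 ≤ r) (hrs : r < s)
    -- quantile levels, weights, and the index used in the normalization
    (τ w : Fin K → ℝ) (hτ : StrictMono τ) (hτ01 : ∀ k, 0 < τ k ∧ τ k < 1)
    (hw : ∀ k, 0 < w k) (kstar : Fin K)
    -- the sets of possible loadings and factors, for each number of factors
    (A F : (ℓ : ℕ) → Set (Fin ℓ → ℝ))
    -- the data, their densities, and the true parameter
    (X : (N T : ℕ) → Fin N → Fin T → Ω → ℝ)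
    (h : (N T : ℕ) → Fin N → Fin T → ℝ → ℝ)
    (θ₀ : (N T : ℕ) → FactorParam K N T r)
    (hmodel : FactorModel P τ X h θ₀)
    (hcons : ConsistencyAssumption P kstar A F X h θ₀)
    (hnum : FactorNumberAssumption s A F h θ₀)
    -- the penalty
    (pen : ℕ → ℕ → ℝ)
    (hpen0 : Tendsto (fun p : ℕ × ℕ => pen p.1 p.2) atTop (𝓝 0))
    (hpenL : Tendsto (fun p : ℕ × ℕ => pen p.1 p.2 * rateL p.1 p.2 ^ 2) atTop atTop)
    -- for each number of factors, a minimizer of the objective over the parameter space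
    (θhat : (ℓ N T : ℕ) → Ω → FactorParam K N T ℓ)
    (hθhat : ∀ᶠ p : ℕ × ℕ in atTop, ∀ ℓ, 1 ≤ ℓ → ℓ ≤ s → ∀ ω,
      θhat ℓ p.1 p.2 ω ∈ paramSpace kstar (A ℓ) (F ℓ) p.1 p.2 ∧
      IsMinOn (objective τ w (fun i t => X p.1 p.2 i t ω))
        (paramSpace kstar (A ℓ) (F ℓ) p.1 p.2) (θhat ℓ p.1 p.2 ω))
    -- a minimizer of the information criterion
    (rhat : (N T : ℕ) → Ω → ℕ)
    (hrhat : ∀ᶠ p : ℕ × ℕ in atTop, ∀ ω,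
      rhat p.1 p.2 ω ∈ Set.Icc 1 s ∧
      IsMinOn (fun ℓ : ℕ => objective τ w (fun i t => X p.1 p.2 i t ω) (θhat ℓ p.1 p.2 ω)
          + ℓ * pen p.1 p.2)
        (Set.Icc 1 s) (rhat p.1 p.2 ω)) :
    -- the second part matters only for a selection `rhat` that is not measurable
    Tendsto (fun p : ℕ × ℕ => P {ω | rhat p.1 p.2 ω = r}) atTop (𝓝 1) ∧
    Tendsto (fun p : ℕ × ℕ => P {ω | rhat p.1 p.2 ω ≠ r}) atTop (𝓝 0) := by
  let bad : ℕ → ℕ × ℕ → Set Ω := fun ℓ p =>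
    {ω | ¬ ∀ θ ∈ paramSpace kstar (A ℓ) (F ℓ) p.1 p.2,
      objective τ w (fun i t => X p.1 p.2 i t ω) (θ₀ p.1 p.2) + r * pen p.1 p.2 <
        objective τ w (fun i t => X p.1 p.2 i t ω) θ + ℓ * pen p.1 p.2}
  have hlim : Tendsto (fun p => ∑ ℓ ∈ (Finset.Icc 1 s).erase r, P.real (bad ℓ p)) atTop (𝓝 0) := by
    have := tendsto_finsetSum ((Finset.Icc 1 s).erase r) fun ℓ hℓ =>
      tendsto_measureReal_not_lt_criterion hr hτ01 hw hmodel hcons hnum hpen0 hpenL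
        (Finset.ne_of_mem_erase hℓ)
    rwa [Finset.sum_const_zero] at this
  have hreal : Tendsto (fun p : ℕ × ℕ => P.real {ω | rhat p.1 p.2 ω ≠ r}) atTop (𝓝 0) := by
    refine squeeze_zero' (Eventually.of_forall fun p => measureReal_nonneg) ?_ hlim
    filter_upwards [hθhat, hrhat, hcons.true_mem] with p hθhat hrhat htrue
    have hsub : {ω | rhat p.1 p.2 ω ≠ r} ⊆ ⋃ ℓ ∈ (Finset.Icc 1 s).erase r, bad ℓ p := by
      intro ω hω
      obtain ⟨hmem, hmin⟩ := hrhat ω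
      refine Set.mem_iUnion₂.2 ⟨rhat p.1 p.2 ω, Finset.mem_erase.2
        ⟨hω, Finset.mem_Icc.2 hmem⟩, fun hgood => ?_⟩
      have h1 := hgood _ (hθhat (rhat p.1 p.2 ω) hmem.1 hmem.2 ω).1
      have h2 := hmin (show r ∈ Set.Icc 1 s from ⟨hr, hrs.le⟩)
      -- The truth competes in the minimization over `Θ^r`, so the criterion at `r` is at most its
      -- value with `θ₀` in place of the fit; this contradicts the strict inequality at `rhat`.
      have h3 := (hθhat r hr hrs.le ω).2 htrue
      simp only [Set.mem_ofPred_eq] at h2 h3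
      linarith
    exact (measureReal_mono hsub (measure_ne_top _ _)).trans (measureReal_biUnion_finset_le _ _)
  have hne : Tendsto (fun p : ℕ × ℕ => P {ω | rhat p.1 p.2 ω ≠ r}) atTop (𝓝 0) :=
    (ENNReal.tendsto_toReal_zero_iff fun p => measure_ne_top _ _).1 hreal
  refine ⟨?_, hne⟩
  have hone : Tendsto (fun p : ℕ × ℕ => 1 - P {ω | rhat p.1 p.2 ω ≠ r}) atTop (𝓝 1) := by
    have := ENNReal.Tendsto.sub tendsto_const_nhds hne (Or.inl ENNReal.one_ne_top)
    simpa using this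
  refine tendsto_of_tendsto_of_tendsto_of_le_of_le hone tendsto_const_nhds (fun p => ?_)
    fun p => prob_le_one
  -- Subadditivity of the outer measure replaces the complement rule, which would require
  -- measurability of `rhat`.
  rw [tsub_le_iff_right, ← measure_univ (μ := P)]
  refine le_trans (measure_mono fun ω _ => ?_) (measure_union_le _ _)
  exact em (rhat p.1 p.2 ω = r)
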